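/- Let $\mathbb K\in\{\mathbb R,\mathbb C\}$, let $M$ be a smooth finite-dimensional (real) Hausdorff, paracompact, connected manifold, let $\mathfrak k$ be a finite-dimensional $\mathbb K$-Lie algebra, and let $\pi:\mathbb L\to M$ be a bundle of Lie algebras with fiber $\mathfrak k$, i.e. a smooth vector bundle which has a bundle atlas whose transition maps take values in $\operatorname{Aut}(\mathfrak k)$. Each fiber $\mathbb L_x$ is then a Lie algebra isomorphic to $\mathfrak k$, and the space $\Gamma(\mathbb L)$ of smooth sections is a $\mathbb K$-Lie algebra under the pointwise bracket. Let $\operatorname{Cent}(\mathfrak g)=\{f\in\operatorname{End}_{\mathbb K}(\mathfrak g): f[x,y]=[x,f(y)]\ \text{for all }x,y\in\mathfrak g\}$ denote the centroid of a Lie algebra $\mathfrak g$. Let $\operatorname{Cent}(\mathbb L)$ and $\operatorname{Der}(\mathbb L)$ be the vector bundles over $M$ with fibers $\operatorname{Cent}(\mathbb L_x)$ and $\operatorname{Der}(\mathbb L_x)$, and let $TM\otimes\operatorname{Cent}(\mathbb L)$ be the bundle with fibers $T_xM\otimes_{\mathbb R}\operatorname{Cent}(\mathbb L_x)$. For $D_0\in\Gamma(\operatorname{Der}(\mathbb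 L))$ let $i(D_0):\Gamma(\mathbb L)\to\Gamma(\mathbb L)$ be given by $(i(D_0)A)(x)=D_0(x)(A(x))$. A Lie connection on $\mathbb L$ is a map $X\mapsto\nabla_X$ from the smooth vector fields $\Gamma(TM)$ to the $\mathbb K$-linear endomorphisms of $\Gamma(\mathbb L)$ such that, for all vector fields $X,Y$ and all $A,B\in\Gamma(\mathbb L)$: $\nabla_X(aA)=(X.a)A+a\nabla_XA$ for all $a\in C^\infty(M,\mathbb K)$; $\nabla_{aX+bY}A=a\nabla_XA+b\nabla_YA$ for all $a,b\in C^\infty(M,\mathbb R)$; and $\nabla_X[A,B]=[\nabla_XA,B]+[A,\nabla_XB]$. Since $(\nabla_XA)(x)$ depends on $X$ only via $X_x$, $\nabla$ extends to $\mathcal Y\in\Gamma(TM\otimes\operatorname{Cent}(\mathbb L))$ by the rule $\nabla_{v\otimes S}A=S(\nabla_vA)$ for $v\in T_xM$, $S\in\operatorname{Cent}(\mathbb L_x)$; that is, $\nabla_{\mathcal Y}=\sum_iS^i\circ\nabla_{\partial_{\xi_i}}$ in a chart $\xi$ of $M$ in which $\mathcal Y=\sum_i\partial_{\xi_i}\otimes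 S^i$. Theorem. Fix a Lie connection $\nabla$ on $\mathbb L$ and suppose that $\mathfrak k$ is perfect ($[\mathfrak k,\mathfrak k]=\mathfrak k$) or centerfree ($\mathfrak z(\mathfrak k)=0$). Then a $\mathbb K$-linear map $D:\Gamma(\mathbb L)\to\Gamma(\mathbb L)$ is a derivation of the Lie algebra $\Gamma(\mathbb L)$ if and only if there are sections $\mathcal Y\in\Gamma(TM\otimes\operatorname{Cent}(\mathbb L))$ and $D_0\in\Gamma(\operatorname{Der}(\mathbb L))$ with $$D=\nabla_{\mathcal Y}+i(D_0),$$ and this decomposition is unique: if $\nabla_{\mathcal Y}+i(D_0)=\nabla_{\mathcal Y'}+i(D_0')$, then $\mathcal Y=\mathcal Y'$ and $D_0=D_0'$. -/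

import Mathlib

open Bundle Set Filter Topology
open scoped Manifold ContDiff TensorProduct

noncomputable section

/-! ### Lie algebras -/

/-- A Lie ring whose additive group carries a norm.  The norm plays no role except to provide the
topology and the differentiable structure of a finite-dimensional Lie algebra, so that it can serve
as the typical fibre of a smooth vector bundle.  No compatibility of bracket and norm is required,
since it is automatic (continuity of the bracket) in finite dimension. -/
class NormedLieRing (𝔨 : Type*) extends NormedAddCommGroup 𝔨, LieRing 𝔨

/-- A Lie algebra `𝔤` is perfect if `[𝔤, 𝔤] = 𝔤`. -/
def IsPerfectLie (K 𝔤 : Type*) [CommRing K] [LieRing 𝔤] [LieAlgebra K 𝔤] : Prop :=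
  ⁅(⊤ : LieIdeal K 𝔤), (⊤ : LieIdeal K 𝔤)⁆ = ⊤

/-- A Lie algebra `𝔤` is centerfree if its center is zero. -/
def IsCenterfreeLie (K 𝔤 : Type*) [CommRing K] [LieRing 𝔤] [LieAlgebra K 𝔤] : Prop :=
  LieAlgebra.center K 𝔤 = ⊥

/-- The centroid of a Lie algebra: the linear endomorphisms which commute with all `ad x`. -/
def lieCentroid (K 𝔤 : Type*) [CommRing K] [LieRing 𝔤] [LieAlgebra K 𝔤] :
    Submodule K (Module.End K 𝔤) where
  carrier := {f | ∀ x y : 𝔤, f ⁅x, y⁆ = ⁅x, f y⁆}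
  add_mem' hf hg x y := by simp [hf x y, hg x y]
  zero_mem' x y := by simp
  smul_mem' c f hf x y := by simp [hf x y]

section PiLie

variable {ι : Type*} {L : ι → Type*} [∀ i, LieRing (L i)]

instance piLieRing : LieRing (∀ i, L i) where
  bracket A B := fun i => ⁅A i, B i⁆
  add_lie A B C := by funext i; exact add_lie _ _ _
  lie_add A B C := by funext i; exact lie_add _ _ _
  lie_self A := by funext i; exact lie_self _
  leibniz_lie A B C := by funext i; exact leibniz_lie _ _ _

instance piLieAlgebra (K : Type*) [CommRing K] [∀ i, LieAlgebra K (L i)] :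
    LieAlgebra K (∀ i, L i) where
  lie_smul c A B := by funext i; exact lie_smul _ _ _

end PiLie

/-! ### Bundles of Lie algebras -/

section Bundle

variable (K : Type*) [RCLike K]
  (E : Type*) [NormedAddCommGroup E] [NormedSpace ℝ E]
  {M : Type*} [TopologicalSpace M] [ChartedSpace E M]
  (𝔨 : Type*) [NormedLieRing 𝔨] [NormedSpace ℝ 𝔨] [LieAlgebra K 𝔨]
  (L : M → Type*) [∀ x, LieRing (L x)] [∀ x, LieAlgebra K (L x)]
  [TopologicalSpace (TotalSpace 𝔨 L)] [∀ x, TopologicalSpace (L x)] [FiberBundle 𝔨 L]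

variable {L 𝔨} in
/-- A bundle chart `e : π⁻¹(U) → U × 𝔨` of the bundle `L`, smooth in both directions, which restricts
on every fibre over `U` to an isomorphism of `K`-Lie algebras `L y ≃ 𝔨`. -/
structure IsLieBundleChart (e : Trivialization 𝔨 (TotalSpace.proj : TotalSpace 𝔨 L → M)) :
    Prop where
  contMDiffOn : ContMDiffOn (𝓘(ℝ, E).prod 𝓘(ℝ, 𝔨)) (𝓘(ℝ, E).prod 𝓘(ℝ, 𝔨)) ∞ e e.source
  contMDiffOn_symm : ContMDiffOn (𝓘(ℝ, E).prod 𝓘(ℝ, 𝔨)) (𝓘(ℝ, E).prod 𝓘(ℝ, 𝔨)) ∞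
    e.toOpenPartialHomeomorph.symm e.target
  exists_lieEquiv : ∀ y ∈ e.baseSet, ∃ φ : L y ≃ₗ⁅K⁆ 𝔨, ∀ v : L y, (e ⟨y, v⟩).2 = φ v

/-- `L` is a bundle of Lie algebras with typical fibre `𝔨`: it has a bundle atlas consisting of
smooth charts which are Lie algebra isomorphisms on the fibres, i.e. whose transition maps
take their values in `Aut(𝔨)`. -/
class IsLieAlgebraBundle : Prop where
  exists_chart : ∀ x : M, ∃ e : Trivialization 𝔨 (TotalSpace.proj : TotalSpace 𝔨 L → M),
    x ∈ e.baseSet ∧ IsLieBundleChart K E e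

variable {K E 𝔨 L}

namespace IsLieBundleChart

variable {e : Trivialization 𝔨 (TotalSpace.proj : TotalSpace 𝔨 L → M)}

theorem contMDiffAt_section_iff (he : IsLieBundleChart K E e) {A : ∀ x, L x} {x : M}
    (hx : x ∈ e.baseSet) :
    ContMDiffAt 𝓘(ℝ, E) (𝓘(ℝ, E).prod 𝓘(ℝ, 𝔨)) ∞ (fun y => TotalSpace.mk' 𝔨 y (A y)) x ↔
      ContMDiffAt 𝓘(ℝ, E) 𝓘(ℝ, 𝔨) ∞ (fun y => (e ⟨y, A y⟩).2) x := by
  constructor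
  · intro h
    have h1 : ContMDiffAt (𝓘(ℝ, E).prod 𝓘(ℝ, 𝔨)) (𝓘(ℝ, E).prod 𝓘(ℝ, 𝔨)) ∞ e
        (TotalSpace.mk' 𝔨 x (A x)) :=
      he.contMDiffOn.contMDiffAt (e.open_source.mem_nhds (by rw [e.mem_source]; exact hx))
    exact contMDiffAt_snd.comp x
      (ContMDiffAt.comp (f := fun y => TotalSpace.mk' 𝔨 y (A y)) x h1 h)
  · intro h
    have h2 : ContMDiffAt 𝓘(ℝ, E) (𝓘(ℝ, E).prod 𝓘(ℝ, 𝔨)) ∞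
        (fun y => (y, (e ⟨y, A y⟩).2)) x := contMDiffAt_id.prodMk h
    have h3 : ContMDiffAt (𝓘(ℝ, E).prod 𝓘(ℝ, 𝔨)) (𝓘(ℝ, E).prod 𝓘(ℝ, 𝔨)) ∞
        e.toOpenPartialHomeomorph.symm (x, (e ⟨x, A x⟩).2) :=
      he.contMDiffOn_symm.contMDiffAt (e.open_target.mem_nhds (by rw [e.mem_target]; exact hx))
    refine (ContMDiffAt.comp (f := fun y => (y, (e ⟨y, A y⟩).2)) x h3 h2).congr_of_eventuallyEq ?_
    filter_upwards [e.open_baseSet.mem_nhds hx] with y hy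
    have : e ⟨y, A y⟩ = (y, (e ⟨y, A y⟩).2) :=
      Prod.ext (e.coe_fst (by rw [e.mem_source]; exact hy)) rfl
    simp only [Function.comp]
    rw [← this]
    exact (e.toOpenPartialHomeomorph.left_inv (by
      show (⟨y, A y⟩ : TotalSpace 𝔨 L) ∈ e.source
      rw [e.mem_source]; exact hy)).symm

theorem map_add (he : IsLieBundleChart K E e) {y : M} (hy : y ∈ e.baseSet) (v w : L y) :
    (e ⟨y, v + w⟩).2 = (e ⟨y, v⟩).2 + (e ⟨y, w⟩).2 := by
  obtain ⟨φ, hφ⟩ := he.exists_lieEquiv y hy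
  simp [hφ]

theorem map_zero (he : IsLieBundleChart K E e) {y : M} (hy : y ∈ e.baseSet) :
    (e ⟨y, (0 : L y)⟩).2 = 0 := by
  obtain ⟨φ, hφ⟩ := he.exists_lieEquiv y hy
  simp [hφ]

theorem map_smul (he : IsLieBundleChart K E e) {y : M} (hy : y ∈ e.baseSet) (c : K) (v : L y) :
    (e ⟨y, c • v⟩).2 = c • (e ⟨y, v⟩).2 := by
  obtain ⟨φ, hφ⟩ := he.exists_lieEquiv y hy
  simp [hφ]

theorem map_lie (he : IsLieBundleChart K E e) {y : M} (hy : y ∈ e.baseSet) (v w : L y) :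
    (e ⟨y, ⁅v, w⁆⟩).2 = ⁅(e ⟨y, v⟩).2, (e ⟨y, w⟩).2⁆ := by
  obtain ⟨φ, hφ⟩ := he.exists_lieEquiv y hy
  rw [hφ, hφ, hφ]
  exact LieEquiv.map_lie φ v w

end IsLieBundleChart

/-! ### Smooth sections -/

variable [IsScalarTower ℝ K 𝔨] [FiniteDimensional K 𝔨]

theorem finiteDimensional_real (K 𝔨 : Type*) [RCLike K] [NormedLieRing 𝔨] [NormedSpace ℝ 𝔨]
    [LieAlgebra K 𝔨] [IsScalarTower ℝ K 𝔨] [FiniteDimensional K 𝔨] : FiniteDimensional ℝ 𝔨 :=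
  FiniteDimensional.trans ℝ K 𝔨

/-- Real-bilinear maps between finite-dimensional spaces preserve smoothness. -/
theorem contMDiffAt_bilin {V W Z : Type*} [NormedAddCommGroup V] [NormedSpace ℝ V]
    [NormedAddCommGroup W] [NormedSpace ℝ W] [NormedAddCommGroup Z] [NormedSpace ℝ Z]
    [FiniteDimensional ℝ V] [FiniteDimensional ℝ W] (β : V →ₗ[ℝ] W →ₗ[ℝ] Z)
    {f : M → V} {g : M → W} {x : M} (hf : ContMDiffAt 𝓘(ℝ, E) 𝓘(ℝ, V) ∞ f x)
    (hg : ContMDiffAt 𝓘(ℝ, E) 𝓘(ℝ, W) ∞ g x) :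
    ContMDiffAt 𝓘(ℝ, E) 𝓘(ℝ, Z) ∞ (fun y => β (f y) (g y)) x := by
  have hβ : ContDiff ℝ ∞ (fun p : V × W => β p.1 p.2) :=
    β.toContinuousBilinearMap.isBoundedBilinearMap.contDiff
  have hm : ContMDiffAt 𝓘(ℝ, V × W) 𝓘(ℝ, Z) ∞ (fun p : V × W => β p.1 p.2) (f x, g x) :=
    hβ.contMDiff.contMDiffAt
  exact ContMDiffAt.comp (f := fun y => (f y, g y)) x hm (hf.prodMk_space hg)

variable (K E 𝔨 L)

/-- The bracket of `𝔨` as a real-bilinear map. -/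
def lieRealBilin : 𝔨 →ₗ[ℝ] 𝔨 →ₗ[ℝ] 𝔨 :=
  LinearMap.mk₂ ℝ (fun v w => ⁅v, w⁆) (fun _ _ _ => add_lie _ _ _)
    (fun c v w => by
      rw [← algebraMap_smul K c v, ← algebraMap_smul K c ⁅v, w⁆, smul_lie])
    (fun _ _ _ => lie_add _ _ _)
    (fun c v w => by
      rw [← algebraMap_smul K c w, ← algebraMap_smul K c ⁅v, w⁆, lie_smul])

/-- Scalar multiplication `K × 𝔨 → 𝔨` as a real-bilinear map. -/
def smulRealBilin : K →ₗ[ℝ] 𝔨 →ₗ[ℝ] 𝔨 :=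
  LinearMap.mk₂ ℝ (fun c v => c • v) (fun _ _ _ => add_smul _ _ _)
    (fun _ _ _ => smul_assoc _ _ _) (fun _ _ _ => smul_add _ _ _)
    (fun c v w => (smul_comm c v w).symm)

variable [IsLieAlgebraBundle K E 𝔨 L]

theorem contMDiff_smul_lieSection {a : M → K} {A : ∀ x, L x}
    (ha : ContMDiff 𝓘(ℝ, E) 𝓘(ℝ, K) ∞ a)
    (hA : ContMDiff 𝓘(ℝ, E) (𝓘(ℝ, E).prod 𝓘(ℝ, 𝔨)) ∞ (fun y => TotalSpace.mk' 𝔨 y (A y))) :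
    ContMDiff 𝓘(ℝ, E) (𝓘(ℝ, E).prod 𝓘(ℝ, 𝔨)) ∞
      (fun y => TotalSpace.mk' 𝔨 y (a y • A y)) := by
  intro x
  have := finiteDimensional_real K 𝔨
  obtain ⟨e, hx, he⟩ := IsLieAlgebraBundle.exists_chart (K := K) (E := E) (𝔨 := 𝔨) (L := L) x
  refine (he.contMDiffAt_section_iff (A := fun y => a y • A y) hx).2 ?_
  refine (contMDiffAt_bilin (smulRealBilin K 𝔨) (ha x)
    ((he.contMDiffAt_section_iff hx).1 (hA x))).congr_of_eventuallyEq ?_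
  filter_upwards [e.open_baseSet.mem_nhds hx] with y hy
  exact he.map_smul hy _ _

/-- `Γ(L)`, the Lie algebra of smooth sections of the bundle of Lie algebras `L`, with the
pointwise operations. -/
def lieSections : LieSubalgebra K (∀ x, L x) where
  carrier := {A | ContMDiff 𝓘(ℝ, E) (𝓘(ℝ, E).prod 𝓘(ℝ, 𝔨)) ∞
    (fun x => TotalSpace.mk' 𝔨 x (A x))}
  add_mem' {A B} hA hB x := by
    obtain ⟨e, hx, he⟩ := IsLieAlgebraBundle.exists_chart (K := K) (E := E) (𝔨 := 𝔨) (L := L) x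
    refine (he.contMDiffAt_section_iff (A := A + B) hx).2 ?_
    refine (((he.contMDiffAt_section_iff hx).1 (hA x)).add
      ((he.contMDiffAt_section_iff hx).1 (hB x))).congr_of_eventuallyEq ?_
    filter_upwards [e.open_baseSet.mem_nhds hx] with y hy
    exact he.map_add hy _ _
  zero_mem' x := by
    obtain ⟨e, hx, he⟩ := IsLieAlgebraBundle.exists_chart (K := K) (E := E) (𝔨 := 𝔨) (L := L) x
    refine (he.contMDiffAt_section_iff (A := 0) hx).2 ?_
    refine (contMDiffAt_const (c := (0 : 𝔨))).congr_of_eventuallyEq ?_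
    filter_upwards [e.open_baseSet.mem_nhds hx] with y hy
    exact he.map_zero hy
  smul_mem' c A hA := contMDiff_smul_lieSection K E 𝔨 L (a := fun _ => c) contMDiff_const hA
  lie_mem' {A B} hA hB x := by
    have := finiteDimensional_real K 𝔨
    obtain ⟨e, hx, he⟩ := IsLieAlgebraBundle.exists_chart (K := K) (E := E) (𝔨 := 𝔨) (L := L) x
    refine (he.contMDiffAt_section_iff (A := ⁅A, B⁆) hx).2 ?_
    refine (contMDiffAt_bilin (lieRealBilin K 𝔨) ((he.contMDiffAt_section_iff hx).1 (hA x))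
      ((he.contMDiffAt_section_iff hx).1 (hB x))).congr_of_eventuallyEq ?_
    filter_upwards [e.open_baseSet.mem_nhds hx] with y hy
    exact he.map_lie hy _ _

variable {K E 𝔨 L} in
theorem lieSections_contMDiffAt (A : lieSections K E 𝔨 L) (x : M) :
    ContMDiffAt 𝓘(ℝ, E) (𝓘(ℝ, E).prod 𝓘(ℝ, 𝔨)) ∞
      (fun y => TotalSpace.mk' 𝔨 y (A.1 y)) x :=
  A.2 x

variable {K E 𝔨 L} in
/-- The product `a A` of a smooth function `a : M → K` and a smooth section `A ∈ Γ(L)`. -/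
def funSmulSection (a : C^∞⟮𝓘(ℝ, E), M; 𝓘(ℝ, K), K⟯) (A : lieSections K E 𝔨 L) :
    lieSections K E 𝔨 L :=
  ⟨fun x => a x • A.1 x, contMDiff_smul_lieSection K E 𝔨 L a.contMDiff A.2⟩

/-- A family `(T x)_x` of linear endomorphisms of the fibres of `L` is smooth on `U` if in every
bundle chart `e` its local form `U ∩ baseSet → End(𝔨)`, `y ↦ e_y ∘ T y ∘ e_y⁻¹`, is smooth.  As `𝔨`
is finite-dimensional, a map to `End(𝔨)` is smooth iff its evaluation at each `v : 𝔨` is. -/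
def IsSmoothEndOn (T : ∀ x, Module.End K (L x)) (U : Set M) : Prop :=
  ∀ e : Trivialization 𝔨 (TotalSpace.proj : TotalSpace 𝔨 L → M), IsLieBundleChart K E e →
    ∀ v : 𝔨, ContMDiffOn 𝓘(ℝ, E) 𝓘(ℝ, 𝔨) ∞ (fun y => (e ⟨y, T y (e.symm y v)⟩).2)
      (e.baseSet ∩ U)

/-- `Γ(Der(L))`, the smooth sections of the bundle whose fibre at `x` is the space of derivations of
the Lie algebra `L x`. -/
@[ext]
structure DerSection where
  toFun : ∀ x, LieDerivation K (L x) (L x)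
  smooth : IsSmoothEndOn K E 𝔨 L (fun x => (toFun x).toLinearMap) univ

variable {K E 𝔨 L} in
/-- A smooth family of endomorphisms of the fibres maps smooth sections to smooth sections. -/
theorem IsSmoothEndOn.contMDiffAt_apply {T : ∀ x, Module.End K (L x)} {U : Set M}
    (hT : IsSmoothEndOn K E 𝔨 L T U) (hU : IsOpen U) {A : ∀ x, L x} {x : M} (hx : x ∈ U)
    (hA : ContMDiffAt 𝓘(ℝ, E) (𝓘(ℝ, E).prod 𝓘(ℝ, 𝔨)) ∞
      (fun y => TotalSpace.mk' 𝔨 y (A y)) x) :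
    ContMDiffAt 𝓘(ℝ, E) (𝓘(ℝ, E).prod 𝓘(ℝ, 𝔨)) ∞
      (fun y => TotalSpace.mk' 𝔨 y (T y (A y))) x := by
  have := finiteDimensional_real K 𝔨
  obtain ⟨e, hxe, he⟩ := IsLieAlgebraBundle.exists_chart (K := K) (E := E) (𝔨 := 𝔨) (L := L) x
  refine (he.contMDiffAt_section_iff (A := fun y => T y (A y)) hxe).2 ?_
  have hA' := (he.contMDiffAt_section_iff hxe).1 hA
  let b := Module.finBasis ℝ 𝔨
  have hterm : ∀ i, ContMDiffAt 𝓘(ℝ, E) 𝓘(ℝ, 𝔨) ∞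
      (fun y => (b.coord i (e ⟨y, A y⟩).2) • (e ⟨y, T y (e.symm y (b i))⟩).2) x := by
    intro i
    have h1 : ContMDiffAt 𝓘(ℝ, E) 𝓘(ℝ, 𝔨) ∞
        (fun y => (e ⟨y, T y (e.symm y (b i))⟩).2) x :=
      (hT e he (b i)).contMDiffAt
        ((e.open_baseSet.inter hU).mem_nhds ⟨hxe, hx⟩)
    exact contMDiffAt_bilin
      (LinearMap.mk₂ ℝ (fun v w : 𝔨 => b.coord i v • w) (by intros; simp [add_smul])
        (by intros; simp [mul_smul]) (by intros; simp)
        (fun c v w => (smul_comm c (b.coord i v) w).symm)) hA' h1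
  have hsum : ContMDiffAt 𝓘(ℝ, E) 𝓘(ℝ, 𝔨) ∞
      (fun y => ∑ i, (b.coord i (e ⟨y, A y⟩).2) • (e ⟨y, T y (e.symm y (b i))⟩).2) x :=
    contMDiffAt_finsetSum (fun i _ => hterm i)
  refine hsum.congr_of_eventuallyEq ?_
  filter_upwards [e.open_baseSet.mem_nhds hxe] with y hy
  obtain ⟨φ, hφ⟩ := he.exists_lieEquiv y hy
  have hs : ∀ v : 𝔨, e.symm y v = φ.symm v := by
    intro v
    apply φ.injective
    change φ (e.symm y v) = φ (φ.symm v)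
    rw [← hφ, LieEquiv.apply_symm_apply]
    rw [show (⟨y, e.symm y v⟩ : TotalSpace 𝔨 L) = _ from e.mk_symm hy v]
    have h3 := e.toOpenPartialHomeomorph.right_inv (x := (y, v)) (by
      show (y, v) ∈ e.target
      rw [e.mem_target]; exact hy)
    exact congrArg Prod.snd h3
  -- the real-linear endomorphism of the typical fibre given by `T y` in the chart
  let Φ : 𝔨 →ₗ[ℝ] 𝔨 := LinearMap.restrictScalars ℝ
    ((φ.toLinearEquiv : L y →ₗ[K] 𝔨) ∘ₗ T y ∘ₗ (φ.toLinearEquiv.symm : 𝔨 →ₗ[K] L y))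
  have hΦ : ∀ v, (e ⟨y, T y (e.symm y v)⟩).2 = Φ v := fun v => by
    rw [hφ, hs]; rfl
  have hΦA : (e ⟨y, T y (A y)⟩).2 = Φ (e ⟨y, A y⟩).2 := by
    rw [hφ, hφ]
    show φ (T y (A y)) = φ (T y (φ.symm (φ (A y))))
    rw [LieEquiv.symm_apply_apply]
  simp only [hΦ, hΦA]
  conv_lhs => rw [← b.sum_repr (e ⟨y, A y⟩).2]
  rw [_root_.map_sum]
  simp only [_root_.map_smul, Module.Basis.coord_apply]

variable {K E 𝔨 L} in
/-- The inclusion `i : Γ(Der(L)) → End(Γ(L))`, `(i(D₀) A)(x) = D₀(x)(A(x))`. -/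
def DerSection.incl (D : DerSection K E 𝔨 L) :
    lieSections K E 𝔨 L →ₗ[K] lieSections K E 𝔨 L where
  toFun A := ⟨fun x => D.toFun x (A.1 x), fun x =>
    D.smooth.contMDiffAt_apply isOpen_univ (mem_univ x) (A.2 x)⟩
  map_add' A B := by ext x; exact _root_.map_add (D.toFun x) _ _
  map_smul' c A := by ext x; exact _root_.map_smul (D.toFun x) _ _

/-! ### Vector fields and Lie connections -/

variable [IsManifold 𝓘(ℝ, E) ∞ M]

variable (M) in
/-- `Γ(TM)`, the smooth vector fields on `M`. -/
abbrev VecField : Type _ := Cₛ^∞⟮𝓘(ℝ, E); E, (TangentSpace 𝓘(ℝ, E) : M → Type _)⟯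

variable {E} in
/-- The product `a X` of a smooth function `a : M → ℝ` and a smooth vector field `X`. -/
def funSmulField (a : C^∞⟮𝓘(ℝ, E), M; 𝓘(ℝ, ℝ), ℝ⟯) (X : VecField E M) : VecField E M :=
  ⟨fun x => a x • X x, a.contMDiff.smul_section X.contMDiff⟩

variable [∀ x, Module ℝ (L x)]

/-- A Lie connection on the bundle of Lie algebras `L`: a covariant derivative `∇` on `L` such that
each `∇_X` is a derivation of the Lie algebra `Γ(L)`. -/
structure LieConnection where
  /-- `∇_X A` is `toFun X A`. -/
  toFun : VecField E M → lieSections K E 𝔨 L →ₗ[K] lieSections K E 𝔨 L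
  /-- `∇_X (a A) = (X.a) A + a ∇_X A`, where `(X.a)(x) = (T_x a)(X_x)`. -/
  leibniz : ∀ (X : VecField E M) (a : C^∞⟮𝓘(ℝ, E), M; 𝓘(ℝ, K), K⟯) (A : lieSections K E 𝔨 L) (x : M),
    (toFun X (funSmulSection a A)).1 x =
      (show K from mfderiv 𝓘(ℝ, E) 𝓘(ℝ, K) a x (X x)) • A.1 x + a x • (toFun X A).1 x
  /-- `∇_{aX + bY} A = a ∇_X A + b ∇_Y A`. -/
  fun_linear : ∀ (a b : C^∞⟮𝓘(ℝ, E), M; 𝓘(ℝ, ℝ), ℝ⟯) (X Y : VecField E M)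
    (A : lieSections K E 𝔨 L) (x : M),
    (toFun (funSmulField a X + funSmulField b Y) A).1 x =
      a x • (toFun X A).1 x + b x • (toFun Y A).1 x
  /-- `∇_X [A, B] = [∇_X A, B] + [A, ∇_X B]`. -/
  map_lie : ∀ (X : VecField E M) (A B : lieSections K E 𝔨 L),
    toFun X ⁅A, B⁆ = ⁅toFun X A, B⁆ + ⁅A, toFun X B⁆

namespace LieConnection

variable {K E 𝔨 L}
variable (conn : LieConnection K E 𝔨 L)

theorem toFun_add (X Y : VecField E M) (A : lieSections K E 𝔨 L) :
    conn.toFun (X + Y) A = conn.toFun X A + conn.toFun Y A := by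
  have h1 : ∀ Z : VecField E M, funSmulField ⟨fun _ => (1 : ℝ), contMDiff_const⟩ Z = Z := by
    intro Z; ext x; exact one_smul ℝ (Z x)
  ext x
  have := conn.fun_linear ⟨fun _ => 1, contMDiff_const⟩ ⟨fun _ => 1, contMDiff_const⟩ X Y A x
  rw [h1, h1] at this
  rw [this]
  exact congrArg₂ (· + ·) (one_smul ℝ _) (one_smul ℝ _)

theorem toFun_smul_apply (a : C^∞⟮𝓘(ℝ, E), M; 𝓘(ℝ, ℝ), ℝ⟯) (X : VecField E M)
    (A : lieSections K E 𝔨 L) (x : M) :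
    (conn.toFun (funSmulField a X) A).1 x = a x • (conn.toFun X A).1 x := by
  have h0 : funSmulField ⟨fun _ => (0 : ℝ), contMDiff_const⟩ X = 0 := by
    ext x; exact zero_smul ℝ (X x)
  have := conn.fun_linear a ⟨fun _ => 0, contMDiff_const⟩ X X A x
  rw [h0, add_zero] at this
  rw [this]
  exact (congrArg₂ (· + ·) rfl (zero_smul ℝ _)).trans (add_zero _)

variable [FiniteDimensional ℝ E] [T2Space M]

/-- Every point of a chart domain has a smooth cut-off function. -/
theorem exists_cutoff (x : M) {U : Set M} (hU : U ∈ 𝓝 x) :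
    ∃ ψ : C^∞⟮𝓘(ℝ, E), M; 𝓘(ℝ, ℝ), ℝ⟯, tsupport ψ ⊆ U ∧ ∀ᶠ y in 𝓝 x, ψ y = 1 := by
  obtain ⟨f, hf⟩ := (SmoothBumpFunction.nhds_basis_tsupport (I := 𝓘(ℝ, E)) x).mem_iff.1 hU
  exact ⟨⟨f, f.contMDiff⟩, hf.2, f.eventuallyEq_one⟩

/-- A smooth local frame of `TM` at `x`, extended to global vector fields by a cut-off. -/
theorem exists_global_frame (x : M) :
    ∃ X : Fin (Module.finrank ℝ E) → VecField E M, ∀ᶠ y in 𝓝 x,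
      y ∈ (trivializationAt E (TangentSpace 𝓘(ℝ, E)) x).baseSet ∧
      ∀ i, X i y = (trivializationAt E (TangentSpace 𝓘(ℝ, E)) x).localFrame
        (Module.finBasis ℝ E) i y := by
  set e := trivializationAt E (TangentSpace 𝓘(ℝ, E)) x with he
  have hx : e.baseSet ∈ 𝓝 x := e.open_baseSet.mem_nhds (FiberBundle.mem_baseSet_trivializationAt' x)
  obtain ⟨ψ, hψ, h1⟩ := exists_cutoff (E := E) x hx
  refine ⟨fun i => ⟨fun y => ψ y • e.localFrame (Module.finBasis ℝ E) i y, ?_⟩, ?_⟩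
  · exact ContMDiffOn.smul_section_of_tsupport (ψ.contMDiff.contMDiffOn) e.open_baseSet hψ
      (e.contMDiffOn_localFrame_baseSet ∞ (Module.finBasis ℝ E) i)
  · filter_upwards [hx, h1] with y hy hy1
    refine ⟨hy, fun i => ?_⟩
    change ψ y • e.localFrame (Module.finBasis ℝ E) i y = _
    rw [hy1, one_smul]

/-- If `Z` vanishes at `x` then so does `∇_Z A`. -/
theorem toFun_apply_eq_zero (Z : VecField E M) (A : lieSections K E 𝔨 L) (x : M)
    (h : Z x = 0) : (conn.toFun Z A).1 x = 0 := by
  set e := trivializationAt E (TangentSpace 𝓘(ℝ, E)) x with he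
  let b := Module.finBasis ℝ E
  have hx : e.baseSet ∈ 𝓝 x := e.open_baseSet.mem_nhds (FiberBundle.mem_baseSet_trivializationAt' x)
  obtain ⟨ψ, hψ, h1⟩ := exists_cutoff (E := E) x hx
  have hψ0 : ∀ y, y ∉ e.baseSet → ψ y = 0 := fun y hy =>
    image_eq_zero_of_notMem_tsupport (fun h' => hy (hψ h'))
  let X : Fin (Module.finrank ℝ E) → VecField E M := fun i =>
    ⟨fun y => ψ y • e.localFrame b i y,
      ContMDiffOn.smul_section_of_tsupport (ψ.contMDiff.contMDiffOn) e.open_baseSet hψ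
        (e.contMDiffOn_localFrame_baseSet ∞ b i)⟩
  let c : Fin (Module.finrank ℝ E) → M → ℝ := fun i y => e.localFrameCoeff 𝓘(ℝ, E) b i y (Z y)
  have hc : ∀ i, ContMDiffOn 𝓘(ℝ, E) 𝓘(ℝ, ℝ) ∞ (c i) e.baseSet := fun i =>
    contMDiffOn_baseSet_localFrameCoeff (b := b) Z.contMDiff.contMDiffOn i
  let a : Fin (Module.finrank ℝ E) → C^∞⟮𝓘(ℝ, E), M; 𝓘(ℝ, ℝ), ℝ⟯ := fun i =>
    ⟨fun y => ψ y * c i y, by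
      refine contMDiff_of_tsupport (fun y hy => ?_)
      have hy' : y ∈ e.baseSet := hψ (closure_mono (fun z hz => by
        simp only [Function.mem_support, ne_eq] at hz ⊢
        exact fun h0 => hz (by rw [h0, zero_mul])) hy)
      exact (ψ.contMDiff y).mul ((hc i).contMDiffAt (e.open_baseSet.mem_nhds hy'))⟩
  have hsum : funSmulField (ψ * ψ) Z = ∑ i, funSmulField (a i) (X i) := by
    ext y
    have hcoe : (∑ i, funSmulField (a i) (X i) : VecField E M) y
        = ∑ i, (ψ y * c i y) • (ψ y • e.localFrame b i y) := by
      rw [← ContMDiffSection.coeAddHom_apply, map_sum, Finset.sum_apply]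
      rfl
    rw [hcoe]
    change (ψ y * ψ y) • Z y = _
    by_cases hy : y ∈ e.baseSet
    · have := Trivialization.eq_sum_localFrameCoeff_smul (I := 𝓘(ℝ, E)) (b := b) (s := fun y => Z y) hy
      conv_lhs => rw [this]
      rw [Finset.smul_sum]
      refine Finset.sum_congr rfl (fun i _ => ?_)
      simp only [smul_smul, c]
      congr 1
      ring
    · simp [hψ0 y hy]
  have hlin : ∀ s : Finset (Fin (Module.finrank ℝ E)),
      (conn.toFun (∑ i ∈ s, funSmulField (a i) (X i)) A).1 x = 0 := by
    intro s
    induction s using Finset.induction_on with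
    | empty =>
      have := conn.toFun_smul_apply ⟨fun _ => 0, contMDiff_const⟩ 0 A x
      rw [Finset.sum_empty, show (0 : VecField E M) =
        funSmulField ⟨fun _ => 0, contMDiff_const⟩ 0 from by ext y; exact (zero_smul ℝ _).symm, this]
      exact zero_smul ℝ _
    | insert i s hi ih =>
      rw [Finset.sum_insert hi, toFun_add]
      change (conn.toFun (funSmulField (a i) (X i)) A).1 x +
        (conn.toFun (∑ i ∈ s, funSmulField (a i) (X i)) A).1 x = 0
      rw [ih, toFun_smul_apply, add_zero]
      have : a i x = 0 := by
        change ψ x * e.localFrameCoeff 𝓘(ℝ, E) b i x (Z x) = 0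
        rw [h, _root_.map_zero, mul_zero]
      rw [this, zero_smul]
  have hfin := conn.toFun_smul_apply (ψ * ψ) Z A x
  rw [hsum, hlin] at hfin
  have hψx : (ψ * ψ) x = 1 := by
    change ψ x * ψ x = 1
    rw [h1.self_of_nhds, one_mul]
  rw [hψx, one_smul] at hfin
  exact hfin.symm

/-- `(∇_X A)(x)` depends on `X` only via its value at `x`. -/
theorem toFun_apply_congr (X Y : VecField E M) (A : lieSections K E 𝔨 L) (x : M)
    (h : X x = Y x) : (conn.toFun X A).1 x = (conn.toFun Y A).1 x := by
  have h1 : X = (X - Y) + Y := by simp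
  rw [h1, toFun_add]
  change (conn.toFun (X - Y) A).1 x + (conn.toFun Y A).1 x = _
  rw [conn.toFun_apply_eq_zero (X - Y) A x (by
    change X x - Y x = 0
    rw [h, sub_self]), zero_add]

/-- Every tangent vector is the value of a smooth vector field. -/
theorem exists_vecField (x : M) (v : TangentSpace 𝓘(ℝ, E) x) : ∃ X : VecField E M, X x = v := by
  set e := trivializationAt E (TangentSpace 𝓘(ℝ, E)) x with he
  have hx := FiberBundle.mem_baseSet_trivializationAt' (F := E) (E := TangentSpace 𝓘(ℝ, E)) x
  obtain ⟨X, hX⟩ := exists_global_frame (E := E) x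
  obtain ⟨-, hX⟩ := hX.self_of_nhds
  let B := e.basisAt (Module.finBasis ℝ E) hx
  refine ⟨∑ i, B.repr v i • X i, ?_⟩
  rw [← ContMDiffSection.coeAddHom_apply, map_sum, Finset.sum_apply]
  conv_rhs => rw [← B.sum_repr v]
  refine Finset.sum_congr rfl (fun i _ => ?_)
  change B.repr v i • X i x = _
  rw [hX i, Trivialization.localFrame_apply_of_mem_baseSet _ _ hx]

/-- `∇_v A ∈ L x` for a tangent vector `v` at `x`: the value `(∇_X A)(x)` for any vector field `X`
with `X x = v`. -/
def atVec (A : lieSections K E 𝔨 L) (x : M) : TangentSpace 𝓘(ℝ, E) x →ₗ[ℝ] L x where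
  toFun v := (conn.toFun (exists_vecField x v).choose A).1 x
  map_add' v w := by
    rw [conn.toFun_apply_congr _ ((exists_vecField x v).choose + (exists_vecField x w).choose) A x
      ((exists_vecField x (v + w)).choose_spec.trans (by
        change _ = (exists_vecField x v).choose x + (exists_vecField x w).choose x
        rw [(exists_vecField x v).choose_spec, (exists_vecField x w).choose_spec])), toFun_add]
    rfl
  map_smul' c v := by
    rw [conn.toFun_apply_congr _
      (funSmulField (ContMDiffMap.const c) (exists_vecField x v).choose) A x
      ((exists_vecField x (c • v)).choose_spec.trans (by
        change _ = c • (exists_vecField x v).choose x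
        rw [(exists_vecField x v).choose_spec])), toFun_smul_apply]
    rfl

theorem atVec_apply (A : lieSections K E 𝔨 L) (x : M) (X : VecField E M) :
    conn.atVec A x (X x) = (conn.toFun X A).1 x :=
  conn.toFun_apply_congr _ _ A x (exists_vecField x (X x)).choose_spec

end LieConnection

/-! ### Sections of `TM ⊗ Cent(L)` and the extension of a Lie connection -/

variable [∀ x, IsScalarTower ℝ K (L x)]

/-- The contraction `T_xM ⊗ Cent(L x) → Cent(L x)`, `v ⊗ S ↦ α(v) S`, with a covector `α`. -/
def contractCovector (x : M) (α : TangentSpace 𝓘(ℝ, E) x →ₗ[ℝ] ℝ) :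
    TangentSpace 𝓘(ℝ, E) x ⊗[ℝ] lieCentroid K (L x) →ₗ[ℝ] lieCentroid K (L x) :=
  (TensorProduct.lid ℝ (lieCentroid K (L x))).toLinearMap ∘ₗ α.rTensor (lieCentroid K (L x))

/-- `Γ(TM ⊗ Cent(L))`, the smooth sections of the bundle with fibres `T_xM ⊗ Cent(L x)`.
Smoothness means that in each chart `ξ` of `M`, where the section has a unique expression
`∑ i, ∂_{ξ_i} ⊗ S i`, the coefficients `S i` are smooth sections of `Cent(L)` over the chart
domain. They are the contractions with the covectors `T ξ_i`; instead of the coordinates `ξ_i` all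
linear functionals of `ξ` are used. -/
@[ext]
structure TangentCentSection where
  toFun : ∀ x : M, TangentSpace 𝓘(ℝ, E) x ⊗[ℝ] lieCentroid K (L x)
  smooth : ∀ (x₀ : M) (l : E →ₗ[ℝ] ℝ),
    IsSmoothEndOn K E 𝔨 L
      (fun y => (contractCovector K E L y
        (l ∘ₗ (mfderiv 𝓘(ℝ, E) 𝓘(ℝ, E) (extChartAt 𝓘(ℝ, E) x₀) y).toLinearMap) (toFun y)).1)
      (chartAt E x₀).source

namespace LieConnection

variable {K E 𝔨 L}
variable (conn : LieConnection K E 𝔨 L) [FiniteDimensional ℝ E] [T2Space M]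

/-- The linear map `T_xM ⊗ Cent(L x) → L x`, `v ⊗ S ↦ S(∇_v A)`. -/
def atTensor (A : lieSections K E 𝔨 L) (x : M) :
    TangentSpace 𝓘(ℝ, E) x ⊗[ℝ] lieCentroid K (L x) →ₗ[ℝ] L x :=
  TensorProduct.lift (LinearMap.mk₂ ℝ
    (fun (v : TangentSpace 𝓘(ℝ, E) x) (S : lieCentroid K (L x)) => S.1 (conn.atVec A x v))
    (fun v w S => by rw [_root_.map_add, _root_.map_add])
    (fun c v S => by
      rw [_root_.map_smul, ← algebraMap_smul K c, _root_.map_smul, algebraMap_smul])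
    (fun v S T => rfl)
    (fun c v S => rfl))

theorem atTensor_tmul (A : lieSections K E 𝔨 L) (x : M) (v : TangentSpace 𝓘(ℝ, E) x)
    (S : lieCentroid K (L x)) : conn.atTensor A x (v ⊗ₜ[ℝ] S) = S.1 (conn.atVec A x v) := rfl

/-- In a chart `ξ`, `∇_𝒴 = ∑ i, S i ∘ ∇_{∂_{ξ_i}}` where `𝒴 = ∑ i, ∂_{ξ_i} ⊗ S i`. -/
theorem atTensor_eq_sum (A : lieSections K E 𝔨 L) (x₀ y : M)
    (hy : y ∈ (trivializationAt E (TangentSpace 𝓘(ℝ, E)) x₀).baseSet)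
    (t : TangentSpace 𝓘(ℝ, E) y ⊗[ℝ] lieCentroid K (L y)) :
    conn.atTensor A y t = ∑ i, (contractCovector K E L y
        ((Module.finBasis ℝ E).coord i ∘ₗ
          (mfderiv 𝓘(ℝ, E) 𝓘(ℝ, E) (extChartAt 𝓘(ℝ, E) x₀) y).toLinearMap) t).1
      (conn.atVec A y ((trivializationAt E (TangentSpace 𝓘(ℝ, E)) x₀).localFrame
        (Module.finBasis ℝ E) i y)) := by
  set e := trivializationAt E (TangentSpace 𝓘(ℝ, E)) x₀ with he
  let b := Module.finBasis ℝ E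
  induction t with
  | zero => simp
  | add s t hs ht => simp [hs, ht, Finset.sum_add_distrib]
  | tmul v S =>
    have hv : v = ∑ i, (b.coord i (mfderiv 𝓘(ℝ, E) 𝓘(ℝ, E) (extChartAt 𝓘(ℝ, E) x₀) y v)) •
        e.localFrame b i y := by
      conv_lhs => rw [← (e.basisAt b hy).sum_repr v]
      refine Finset.sum_congr rfl (fun i _ => ?_)
      rw [Trivialization.localFrame_apply_of_mem_baseSet _ _ hy,
        ← TangentBundle.continuousLinearMapAt_trivializationAt (I := 𝓘(ℝ, E)) hy]
      congr 1
      change b.repr (e.linearEquivAt ℝ y hy v) i = b.repr (e.continuousLinearMapAt ℝ y v) i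
      congr 2
      rw [e.continuousLinearMapAt_apply (R := ℝ), e.coe_linearMapAt_of_mem hy]
      rfl
    rw [atTensor_tmul]
    conv_lhs => rw [hv]
    rw [_root_.map_sum, _root_.map_sum]
    refine Finset.sum_congr rfl (fun i _ => ?_)
    rw [_root_.map_smul, ← algebraMap_smul K, _root_.map_smul, algebraMap_smul]
    rfl

theorem contMDiff_atTensor (Y : TangentCentSection K E 𝔨 L) (A : lieSections K E 𝔨 L) :
    ContMDiff 𝓘(ℝ, E) (𝓘(ℝ, E).prod 𝓘(ℝ, 𝔨)) ∞
      (fun x => TotalSpace.mk' 𝔨 x (conn.atTensor A x (Y.toFun x))) := by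
  intro x
  obtain ⟨X, hX⟩ := exists_global_frame (E := E) x
  have hx : x ∈ (chartAt E x).source := mem_chart_source E x
  -- the local expression as a finite sum of smooth sections
  let T : Fin (Module.finrank ℝ E) → ∀ y, Module.End K (L y) := fun i y =>
    (contractCovector K E L y ((Module.finBasis ℝ E).coord i ∘ₗ
      (mfderiv 𝓘(ℝ, E) 𝓘(ℝ, E) (extChartAt 𝓘(ℝ, E) x) y).toLinearMap) (Y.toFun y)).1
  have hterm : ∀ i, ContMDiffAt 𝓘(ℝ, E) (𝓘(ℝ, E).prod 𝓘(ℝ, 𝔨)) ∞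
      (fun y => TotalSpace.mk' 𝔨 y (T i y ((conn.toFun (X i) A).1 y))) x := fun i =>
    (Y.smooth x ((Module.finBasis ℝ E).coord i)).contMDiffAt_apply (chartAt E x).open_source hx
      ((conn.toFun (X i) A).2 x)
  obtain ⟨e, hxe, he⟩ := IsLieAlgebraBundle.exists_chart (K := K) (E := E) (𝔨 := 𝔨) (L := L) x
  refine (he.contMDiffAt_section_iff (A := fun y => conn.atTensor A y (Y.toFun y)) hxe).2 ?_
  have hsum : ContMDiffAt 𝓘(ℝ, E) 𝓘(ℝ, 𝔨) ∞
      (fun y => ∑ i, (e ⟨y, T i y ((conn.toFun (X i) A).1 y)⟩).2) x :=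
    contMDiffAt_finsetSum (fun i _ =>
      (he.contMDiffAt_section_iff (A := fun y => T i y ((conn.toFun (X i) A).1 y)) hxe).1 (hterm i))
  refine hsum.congr_of_eventuallyEq ?_
  filter_upwards [hX, e.open_baseSet.mem_nhds hxe] with y hy hye
  obtain ⟨φ, hφ⟩ := he.exists_lieEquiv y hye
  simp only [hφ]
  rw [conn.atTensor_eq_sum A x y hy.1]
  change φ.toLinearEquiv _ = ∑ i, φ.toLinearEquiv _
  rw [_root_.map_sum]
  refine Finset.sum_congr rfl (fun i _ => ?_)
  rw [← hy.2 i, conn.atVec_apply]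

/-- The extension of the connection `∇` to `𝒴 ∈ Γ(TM ⊗ Cent(L))`: the operator `∇_𝒴` on `Γ(L)`
which is given at each point by the rule `∇_{v ⊗ S} A = S(∇_v A)`, i.e. by
`∇_𝒴 = ∑ i, S i ∘ ∇_{∂_{ξ_i}}` in a chart `ξ` in which `𝒴 = ∑ i, ∂_{ξ_i} ⊗ S i`. -/
def extension (Y : TangentCentSection K E 𝔨 L) :
    lieSections K E 𝔨 L →ₗ[K] lieSections K E 𝔨 L where
  toFun A := ⟨fun x => conn.atTensor A x (Y.toFun x), conn.contMDiff_atTensor Y A⟩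
  map_add' A B := by
    ext x
    change conn.atTensor (A + B) x (Y.toFun x) =
      conn.atTensor A x (Y.toFun x) + conn.atTensor B x (Y.toFun x)
    induction Y.toFun x with
    | zero => simp
    | add s t hs ht => simp only [_root_.map_add, hs, ht]; abel
    | tmul v S =>
      simp only [atTensor_tmul]
      rw [← _root_.map_add]
      congr 1
      change (conn.toFun _ (A + B)).1 x = _
      rw [_root_.map_add]
      rfl
  map_smul' c A := by
    ext x
    change conn.atTensor (c • A) x (Y.toFun x) = c • conn.atTensor A x (Y.toFun x)
    induction Y.toFun x with
    | zero => simp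
    | add s t hs ht => simp only [_root_.map_add, hs, ht, smul_add]
    | tmul v S =>
      simp only [atTensor_tmul]
      rw [← _root_.map_smul]
      congr 1
      change (conn.toFun _ (c • A)).1 x = _
      rw [_root_.map_smul]
      rfl

end LieConnection

end Bundle

end

/-! ### Hadamard's lemma -/

section Hadamard

variable {E : Type*} [NormedAddCommGroup E] [NormedSpace ℝ E] [FiniteDimensional ℝ E]

/-! Everything rests on the symbol of a derivation `D`, its commutator `[D, a]` with multiplication
by a smooth function `a`. Expanding `D[A, aB] = D(a[A, B])` on both sides shows that it lies in the
centroid of `Γ(L)` (`symbol_mem_lieCentroid`). The hypothesis on `𝔨` enters through one fact: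
elements of this centroid are linear over the smooth functions (`isFunLinear_of_mem_lieCentroid`),
so the symbol acts fibrewise, by elements of `Cent(L x)`. As a function of a real-valued `f`, the
symbol at `x` is then a derivation at `x` with values in `Cent(L x)`. By Hadamard's lemma it depends
only on `df(x)` (`pointDerivation_eq_zero`), so it is the contraction of `df(x)` with a tensor in
`T_xM ⊗ Cent(L x)`. These tensors form a smooth section `𝒴` (`exists_tangentCentSection`).

The operator `∇_𝒴` is a derivation with the same symbol as `D` on real functions. Hence `D - ∇_𝒴` is
a function-linear derivation, and such a derivation is `i(D₀)` for a section `D₀`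
(`IsFunLinear.exists_derSection`). For uniqueness, `i(D₀)` has zero symbol and the differentials of
global functions exhaust the covectors at each point; so the operator determines `𝒴`, and then `D₀`.

Function-linearity of the centroid is short when the center is zero. When `𝔨` is perfect, it needs
every section to be a finite sum of brackets of global sections (`mem_span_lie_of_isPerfectLie`).
Locally this is linear algebra. Since `M` may be noncompact, finiteness comes from a locally finite
cover with finitely many colours in which sets of equal colour are disjoint: local brackets of one
colour add up without cross terms. The bound on the number of colours comes from the Besicovitch
covering theorem in charts. -/

theorem hasFDerivAt_intervalIntegral_of_contDiff {F : E × ℝ → ℝ} (hF : ContDiff ℝ 1 F) (x : E) :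
    HasFDerivAt (fun x => ∫ t in (0 : ℝ)..1, F (x, t))
      (∫ t in (0 : ℝ)..1, (fderiv ℝ F (x, t)).comp (ContinuousLinearMap.inl ℝ E ℝ)) x := by
  have hF' : Continuous (fun p : E × ℝ =>
      (fderiv ℝ F p).comp (ContinuousLinearMap.inl ℝ E ℝ)) :=
    (hF.continuous_fderiv one_ne_zero).clm_comp continuous_const
  -- Continuity on a compact set gives a constant that dominates the derivatives for all base points
  -- in the unit ball around `x`.
  obtain ⟨C, hC⟩ := ((isCompact_closedBall x 1).prod
    (isCompact_Icc (a := (0 : ℝ)) (b := 1))).exists_bound_of_continuousOn hF'.continuousOn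
  refine intervalIntegral.hasFDerivAt_integral_of_dominated_of_fderiv_le
    (F := fun x t => F (x, t)) (bound := fun _ => C)
    (F' := fun x t => (fderiv ℝ F (x, t)).comp (ContinuousLinearMap.inl ℝ E ℝ))
    (Metric.ball_mem_nhds x one_pos) ?_ ?_ ?_ ?_ ?_ ?_
  · exact Eventually.of_forall fun y =>
      (hF.continuous.comp (Continuous.prodMk_right y)).aestronglyMeasurable
  · exact (hF.continuous.comp (Continuous.prodMk_right x)).intervalIntegrable _ _
  · exact (hF'.comp (Continuous.prodMk_right x)).aestronglyMeasurable
  · refine Eventually.of_forall fun t ht y hy => hC (y, t) ⟨Metric.ball_subset_closedBall hy, ?_⟩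
    rw [uIoc_of_le zero_le_one] at ht
    exact Ioc_subset_Icc_self ht
  · exact intervalIntegrable_const
  · refine Eventually.of_forall fun t ht y hy => ?_
    have h1 := ((hF.differentiable one_ne_zero) (y, t)).hasFDerivAt
    exact h1.comp y (hasFDerivAt_prodMk_left y t)

/-- A parametric integral of a smooth function is smooth. -/
theorem contDiff_intervalIntegral {F : E × ℝ → ℝ} (hF : ContDiff ℝ ∞ F) :
    ContDiff ℝ ∞ (fun x => ∫ t in (0 : ℝ)..1, F (x, t)) := by
  rw [contDiff_infty]
  intro n
  induction n generalizing F with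
  | zero =>
    refine contDiff_zero.2 ?_
    exact (continuous_iff_continuousAt.2 fun x =>
      (hasFDerivAt_intervalIntegral_of_contDiff (hF.of_le (by simp)) x).continuousAt)
  | succ n ih =>
    have hd := fun x => hasFDerivAt_intervalIntegral_of_contDiff (F := F) (hF.of_le (by simp)) x
    push_cast
    rw [contDiff_succ_iff_fderiv_apply]
    refine ⟨fun x => (hd x).differentiableAt, by simp, fun y => ?_⟩
    -- The derivative of the integral in direction `y` is again a parametric integral, with
    -- integrand `∂_y F`; hence the induction over all `F`.
    have h2 : ContDiff ℝ ∞ (fun p : E × ℝ => fderiv ℝ F p (y, 0)) :=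
      (hF.fderiv_right (m := ∞) (by simp)).clm_apply contDiff_const
    convert ih h2 using 1
    funext x
    have hc : Continuous (fun t : ℝ =>
        (fderiv ℝ F (x, t)).comp (ContinuousLinearMap.inl ℝ E ℝ)) :=
      ((hF.continuous_fderiv (by simp)).comp (Continuous.prodMk_right x)).clm_comp continuous_const
    rw [(hd x).fderiv, ContinuousLinearMap.intervalIntegral_apply (hc.intervalIntegrable _ _)]
    rfl

/-- **Hadamard's lemma**. -/
theorem exists_hadamard {g : E → ℝ} (hg : ContDiff ℝ ∞ g) (z₀ : E) {ι : Type*} [Fintype ι]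
    (b : Module.Basis ι ℝ E) :
    ∃ h : ι → E → ℝ, (∀ i, ContDiff ℝ ∞ (h i)) ∧ (∀ i, h i z₀ = fderiv ℝ g z₀ (b i)) ∧
      ∀ z, g z = g z₀ + ∑ i, b.repr (z - z₀) i * h i z := by
  have hline : ContDiff ℝ ∞ (fun p : E × ℝ => z₀ + p.2 • (p.1 - z₀)) := by fun_prop
  have hdg : ContDiff ℝ ∞ (fderiv ℝ g) := hg.fderiv_right (m := ∞) (by simp)
  -- The factors are the partial derivatives averaged over the segment from `z₀` to `z`; at `z = z₀`
  -- the integrand is constant.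
  refine ⟨fun i z => ∫ t in (0 : ℝ)..1, fderiv ℝ g (z₀ + t • (z - z₀)) (b i), fun i => ?_,
    fun i => by simp, fun z => ?_⟩
  · exact contDiff_intervalIntegral (F := fun p : E × ℝ => fderiv ℝ g (z₀ + p.2 • (p.1 - z₀)) (b i))
      ((hdg.comp hline).clm_apply contDiff_const)
  · have hcont : ∀ v, Continuous (fun t : ℝ => fderiv ℝ g (z₀ + t • (z - z₀)) v) := fun v =>
      (hdg.continuous.comp (by fun_prop)).clm_apply continuous_const
    have hderiv : ∀ t : ℝ, HasDerivAt (fun t : ℝ => g (z₀ + t • (z - z₀)))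
        (fderiv ℝ g (z₀ + t • (z - z₀)) (z - z₀)) t := by
      intro t
      have h1 : HasDerivAt (fun t : ℝ => z₀ + t • (z - z₀)) (z - z₀) t := by
        simpa using ((hasDerivAt_id t).smul_const (z - z₀)).const_add z₀
      exact ((hg.differentiable (by simp)) _).hasFDerivAt.comp_hasDerivAt t h1
    have h2 := intervalIntegral.integral_eq_sub_of_hasDerivAt (a := 0) (b := 1)
      (fun t _ => hderiv t) ((hcont _).intervalIntegrable _ _)
    simp only [one_smul, zero_smul, add_zero, add_sub_cancel] at h2
    rw [← sub_eq_iff_eq_add', ← h2]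
    simp only [← intervalIntegral.integral_const_mul]
    rw [← intervalIntegral.integral_finsetSum
      (fun i _ => ((hcont _).const_mul _).intervalIntegrable _ _)]
    congr 1
    funext t
    conv_lhs => rw [← b.sum_repr (z - z₀), _root_.map_sum]
    -- The expansion in the basis also hit the base point of the derivative; this undoes it there.
    rw [b.sum_repr]
    simp

end Hadamard

/-! ### Coloured covers -/

section ColorCover

/-- Every neighbourhood assignment `U` has a refinement covering `K` which consists of `N` finite
families of pairwise disjoint closed sets (the interiors of the sets cover `K`). -/
def HasColorCover {X : Type*} [TopologicalSpace X] (N : ℕ) (K : Set X) : Prop :=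
  ∀ U : X → Set X, (∀ x, U x ∈ 𝓝 x) → ∃ F : Fin N → Set (Set X),
    (∀ c, (F c).Finite) ∧ (∀ c, ∀ C ∈ F c, IsClosed C ∧ ∃ x, C ⊆ U x) ∧
    (∀ c, (F c).PairwiseDisjoint id) ∧ ∀ x ∈ K, ∃ c, ∃ C ∈ F c, x ∈ interior C

variable {X : Type*} [TopologicalSpace X] {N : ℕ} {K K' : Set X}

theorem HasColorCover.mono (h : HasColorCover N K') (hK : K ⊆ K') : HasColorCover N K := by
  intro U hU
  obtain ⟨F, h1, h2, h3, h4⟩ := h U hU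
  exact ⟨F, h1, h2, h3, fun x hx => h4 x (hK hx)⟩

theorem hasColorCover_empty : HasColorCover N (∅ : Set X) := fun _ _ =>
  ⟨fun _ => ∅, by simp, by simp, by simp, by simp⟩

/-- No new colour is needed, because a set of the second family that meets a set of the first family
of the same colour is absorbed into it. The second family is chosen after the first, so fine that
each of its sets meets at most one set of each colour and then lies in the neighbourhood which
contains that set. Passing to interiors of the `U x` leaves room for this enlargement. -/
theorem HasColorCover.union (h : HasColorCover N K) (h' : HasColorCover N K') :
    HasColorCover N (K ∪ K') := by
  intro U hU
  have hU' : ∀ x, interior (U x) ∈ 𝓝 x := fun x => interior_mem_nhds.2 (hU x)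
  obtain ⟨F, hfin, hF, hdisj, hcov⟩ := h (fun x => interior (U x)) hU'
  have hcl : ∀ c, ∀ C ∈ F c, ∃ x, C ⊆ interior (U x) := fun c C hC => (hF c C hC).2
  rcases isEmpty_or_nonempty X
  · exact ⟨fun _ => ∅, by simp, by simp, by simp, fun x => isEmptyElim x⟩
  choose! p hp using hcl
  -- neighbourhoods meeting at most one set of each colour
  let W : X → Set X := fun x => U x ∩ ⋂ c, ⋂ C ∈ F c,
    {y | (x ∈ C → y ∈ interior (U (p c C))) ∧ (x ∉ C → y ∉ C)}
  have hW : ∀ x, W x ∈ 𝓝 x := by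
    intro x
    refine inter_mem (hU x) ((iInter_mem).2 fun c => (biInter_mem (hfin c)).2 fun C hC => ?_)
    by_cases hx : x ∈ C
    · filter_upwards [isOpen_interior.mem_nhds (hp c C hC hx)] with y hy
      exact ⟨fun _ => hy, fun h => (h hx).elim⟩
    · filter_upwards [(hF c C hC).1.isOpen_compl.mem_nhds hx] with y hy
      exact ⟨fun h => (hx h).elim, fun _ => hy⟩
  obtain ⟨G, hGfin, hG, hGdisj, hGcov⟩ := h' W hW
  have hGW : ∀ c, ∀ D ∈ G c, ∀ C ∈ F c, (D ∩ C).Nonempty →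
      D ⊆ interior (U (p c C)) ∧ ∀ C' ∈ F c, (D ∩ C').Nonempty → C' = C := by
    intro c D hD C hC ⟨y, hyD, hyC⟩
    obtain ⟨-, x, hx⟩ := hG c D hD
    have key : ∀ z ∈ D, ∀ C' ∈ F c,
        (x ∈ C' → z ∈ interior (U (p c C'))) ∧ (x ∉ C' → z ∉ C') := fun z hz C' hC' => by
      have := (hx hz).2
      simp only [mem_iInter] at this
      exact this c C' hC'
    have hxC : x ∈ C := by_contra fun h => (key y hyD C hC).2 h hyC
    refine ⟨fun z hz => (key z hz C hC).1 hxC, fun C' hC' ⟨z, hzD, hzC'⟩ => ?_⟩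
    have hxC' : x ∈ C' := by_contra fun h => (key z hzD C' hC').2 h hzC'
    exact (hdisj c).elim_set hC' hC x hxC' hxC
  -- `Φ c C` is `C` together with all sets of `G c` that meet it. The sets of `G c` that meet no set
  -- of `F c` are kept unchanged.
  let Φ : Fin N → Set X → Set X := fun c C => C ∪ ⋃ D ∈ {D ∈ G c | (D ∩ C).Nonempty}, D
  have hΦ : ∀ c C z, z ∈ Φ c C ↔ z ∈ C ∨ ∃ D ∈ G c, (D ∩ C).Nonempty ∧ z ∈ D := by
    intro c C z
    simp only [Φ, mem_union, mem_iUnion, mem_ofPred_eq, exists_prop, and_assoc]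
  refine ⟨fun c => Φ c '' F c ∪ {D ∈ G c | ∀ C ∈ F c, ¬ (D ∩ C).Nonempty}, fun c => ?_,
    fun c C hC => ?_, fun c => ?_, fun x hx => ?_⟩
  · exact ((hfin c).image _).union ((hGfin c).subset (sep_subset _ _))
  · rcases hC with ⟨C, hC, rfl⟩ | ⟨hC, -⟩
    · refine ⟨(hF c C hC).1.union (((hGfin c).subset (sep_subset _ _)).isClosed_biUnion
        fun D hD => (hG c D hD.1).1), p c C, fun z hz => ?_⟩
      rcases (hΦ c C z).1 hz with hz | ⟨D, hD, hDC, hz⟩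
      · exact interior_subset (hp c C hC hz)
      · exact interior_subset ((hGW c D hD C hC hDC).1 hz)
    · obtain ⟨h1, x, hx⟩ := hG c C hC
      exact ⟨h1, x, fun z hz => (hx hz).1⟩
  · have aux : ∀ C ∈ F c, ∀ D ∈ G c, (∀ C ∈ F c, ¬ (D ∩ C).Nonempty) → ∀ z ∈ Φ c C, z ∉ D := by
      intro C hC D hD hDn z hz hzD
      rcases (hΦ c C z).1 hz with hz | ⟨D', hD', hDC, hz⟩
      · exact hDn C hC ⟨z, hzD, hz⟩
      · have : D = D' := (hGdisj c).elim_set hD hD' z hzD hz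
        exact hDn C hC (this ▸ hDC)
    rintro _ (⟨C, hC, rfl⟩ | ⟨hD, hDn⟩) _ (⟨C', hC', rfl⟩ | ⟨hD', hDn'⟩) hne
    · refine disjoint_left.2 fun z hz hz' => hne ?_
      suffices C = C' by rw [this]
      rcases (hΦ c C z).1 hz with hz | ⟨D, hD, hDC, hz⟩ <;>
        rcases (hΦ c C' z).1 hz' with hz' | ⟨D', hD', hDC', hz'⟩
      · exact (hdisj c).elim_set hC hC' z hz hz'
      · exact (hGW c D' hD' C' hC' hDC').2 C hC ⟨z, hz', hz⟩
      · exact ((hGW c D hD C hC hDC).2 C' hC' ⟨z, hz, hz'⟩).symm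
      · have : D = D' := (hGdisj c).elim_set hD hD' z hz hz'
        exact (hGW c D' hD' C' hC' hDC').2 C hC (this ▸ hDC)
    · exact disjoint_left.2 fun z hz hz' => aux C hC _ hD' hDn' z hz hz'
    · exact disjoint_left.2 fun z hz hz' => aux C' hC' _ hD hDn z hz' hz
    · exact hGdisj c hD hD' hne
  · rcases hx with hx | hx
    · obtain ⟨c, C, hC, hx⟩ := hcov x hx
      exact ⟨c, Φ c C, Or.inl ⟨C, hC, rfl⟩, interior_mono subset_union_left hx⟩
    · obtain ⟨c, D, hD, hx⟩ := hGcov x hx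
      by_cases hn : ∀ C ∈ F c, ¬ (D ∩ C).Nonempty
      · exact ⟨c, D, Or.inr ⟨hD, hn⟩, hx⟩
      · push Not at hn
        obtain ⟨C, hC, hDC⟩ := hn
        refine ⟨c, Φ c C, Or.inl ⟨C, hC, rfl⟩, interior_mono ?_ hx⟩
        exact fun z hz => (hΦ c C z).2 (Or.inr ⟨D, hD, hDC, hz⟩)

variable {E : Type*} [NormedAddCommGroup E] [NormedSpace ℝ E] [FiniteDimensional ℝ E]

/-- The number of colours needed depends only on the model space. -/
theorem exists_hasColorCover_of_isCompact (E : Type*) [NormedAddCommGroup E] [NormedSpace ℝ E]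
    [FiniteDimensional ℝ E] (M : Type*) [TopologicalSpace M] [ChartedSpace E M] [T2Space M] :
    ∃ N : ℕ, ∀ K : Set M, IsCompact K → HasColorCover N K := by
  -- `N` is a Besicovitch number of `E`. As unions preserve `N`, induction over compact sets reduces
  -- the claim to a small neighbourhood inside one chart.
  obtain ⟨N, τ, hτ, hN⟩ := HasBesicovitchCovering.no_satelliteConfig (α := E)
  refine ⟨N, fun K hK => hK.induction_on hasColorCover_empty (fun _ _ h h' => h'.mono h)
    (fun _ _ => HasColorCover.union) fun x₀ _ => ?_⟩
  have : LocallyCompactSpace M := ChartedSpace.locallyCompactSpace E M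
  obtain ⟨S, hSx, hSs, hS⟩ := local_compact_nhds ((chartAt E x₀).open_source.mem_nhds
    (mem_chart_source E x₀))
  refine ⟨S, mem_nhdsWithin_of_mem_nhds hSx, fun U hU => ?_⟩
  set φ := chartAt E x₀
  -- The covering theorem requires uniformly bounded radii, here bounded by 1.
  have hr : ∀ x ∈ S, ∃ r, 0 < r ∧ r ≤ 1 ∧
      Metric.closedBall (φ x) r ⊆ φ.target ∩ φ.symm ⁻¹' U x := by
    intro x hx
    have h1 : φ.target ∩ φ.symm ⁻¹' U x ∈ 𝓝 (φ x) := by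
      refine inter_mem (φ.open_target.mem_nhds (φ.map_source (hSs hx))) ?_
      exact (φ.continuousAt_symm (φ.map_source (hSs hx))).preimage_mem_nhds
        (by rw [φ.left_inv (hSs hx)]; exact hU x)
    obtain ⟨ε, hε, h2⟩ := Metric.nhds_basis_closedBall.mem_iff.1 h1
    exact ⟨min ε 1, lt_min hε one_pos, min_le_right _ _,
      (Metric.closedBall_subset_closedBall (min_le_left _ _)).trans h2⟩
  choose! r hr0 hr1 hrU using hr
  let q : Besicovitch.BallPackage S E :=
    ⟨fun x => φ x, fun x => r x, fun x => hr0 x x.2, 1, fun x => hr1 x x.2⟩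
  obtain ⟨s, hs, hcov⟩ := Besicovitch.exist_disjoint_covering_families hτ hN q
  have hsub : ∀ x : S, Metric.closedBall (φ x) (r x) ⊆ φ.target := fun x y hy => (hrU x x.2 hy).1
  let Cl : S → Set M := fun x => φ.symm '' Metric.closedBall (φ x) (r x)
  have hint : ∀ x : S, φ.symm '' Metric.ball (φ x) (r x) ⊆ interior (Cl x) := fun x =>
    interior_maximal (image_mono Metric.ball_subset_closedBall)
      (φ.isOpen_image_symm_of_subset_target Metric.isOpen_ball
        (Metric.ball_subset_closedBall.trans (hsub x)))
  have hcov' : ∀ y ∈ S, ∃ p : Fin N × S, p.2 ∈ s p.1 ∧ y ∈ interior (Cl p.2) := by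
    intro y hy
    obtain ⟨c, hc⟩ := mem_iUnion.1 (hcov ⟨⟨y, hy⟩, rfl⟩)
    obtain ⟨x, hx, hyx⟩ := mem_iUnion₂.1 hc
    exact ⟨(c, x), hx, hint x ⟨φ y, hyx, φ.left_inv (hSs hy)⟩⟩
  rcases S.eq_empty_or_nonempty with rfl | ⟨y₀, hy₀⟩
  · exact hasColorCover_empty U hU
  have : Nonempty (Fin N × S) := ⟨(hcov' y₀ hy₀).choose⟩
  choose! g hg using hcov'
  -- The Besicovitch families may be infinite. Compactness of `S` selects finitely many balls, and
  -- disjointness within a colour passes to subfamilies.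
  obtain ⟨t, htcov⟩ := hS.elim_nhds_subcover' (fun y _ => interior (Cl (g y).2))
    (fun y hy => isOpen_interior.mem_nhds (hg y hy).2)
  refine ⟨fun c => Cl '' {x | ∃ y ∈ t, g y = (c, x)}, fun c => ?_, fun c => ?_, fun c => ?_,
    fun y hy => ?_⟩
  · refine Finite.image _ ((t.finite_toSet.image (fun y : S => (g y).2)).subset ?_)
    rintro x ⟨y, hy, h⟩
    exact ⟨y, hy, by simp [h]⟩
  · rintro _ ⟨x, -, rfl⟩
    refine ⟨IsCompact.isClosed ((isCompact_closedBall _ _).image_of_continuousOn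
      (φ.continuousOn_symm.mono (hsub x))), x, ?_⟩
    rintro _ ⟨z, hz, rfl⟩
    exact (hrU x x.2 hz).2
  · rintro _ ⟨x, ⟨y, hy, h⟩, rfl⟩ _ ⟨x', ⟨y', hy', h'⟩, rfl⟩ hne
    have hx : x ∈ s c := by have := (hg y y.2).1; rwa [h] at this
    have hx' : x' ∈ s c := by have := (hg y' y'.2).1; rwa [h'] at this
    refine disjoint_left.2 ?_
    rintro _ ⟨z, hz, rfl⟩ ⟨z', hz', hzz⟩
    have : z' = z := φ.symm.injOn (hsub x' hz') (hsub x hz) hzz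
    exact hne (by rw [(hs c).elim_set hx hx' z hz (this ▸ hz')])
  · obtain ⟨z, hz, hyz⟩ := mem_iUnion₂.1 (htcov hy)
    exact ⟨(g z).1, Cl (g z).2, ⟨(g z).2, ⟨z, hz, rfl⟩, rfl⟩, hyz⟩

end ColorCover

/-! ### σ-compactness -/

/-- A connected, paracompact, locally compact Hausdorff space is σ-compact. -/
theorem sigmaCompactSpace_of_connected (X : Type*) [TopologicalSpace X] [T2Space X]
    [ParacompactSpace X] [ConnectedSpace X] [LocallyCompactSpace X] : SigmaCompactSpace X := by
  choose k hkc hk using fun x : X => exists_compact_mem_nhds x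
  obtain ⟨v, hvo, hvu, hvf, hvk⟩ := precise_refinement (fun x => interior (k x))
    (fun _ => isOpen_interior) (iUnion_eq_univ_iff.2 fun x =>
      ⟨x, mem_interior_iff_mem_nhds.2 (hk x)⟩)
  obtain ⟨x₀⟩ := (inferInstance : Nonempty X)
  -- Start at a point and repeatedly take all compact sets `k a` whose refined set `v a` meets the
  -- previous stage. By local finiteness only finitely many occur, so every stage is compact.
  let C : ℕ → Set X := fun n =>
    n.rec {x₀} (fun _ C => ⋃ a ∈ {a | (v a ∩ C).Nonempty}, k a)
  have hCs : ∀ n, C (n + 1) = ⋃ a ∈ {a | (v a ∩ C n).Nonempty}, k a := fun _ => rfl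
  have hC : ∀ n, IsCompact (C n) := by
    intro n
    induction n with
    | zero => exact isCompact_singleton
    | succ n ih =>
      rw [hCs]
      exact (hvf.finite_nonempty_inter_compact ih).isCompact_biUnion fun a _ => hkc a
  have hsub : ∀ n a, (v a ∩ C n).Nonempty → v a ⊆ ⋃ n, C n := by
    intro n a ha x hx
    refine mem_iUnion.2 ⟨n + 1, ?_⟩
    rw [hCs]
    exact mem_iUnion₂.2 ⟨a, ha, interior_subset (hvk a hx)⟩
  -- The union contains every `v a` that it meets, and the open sets `v a` cover the space.
  have hclopen : IsClopen (⋃ n, C n) := by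
    refine ⟨isClosed_of_closure_subset fun x hx => ?_, isOpen_iff_mem_nhds.2 fun x hx => ?_⟩
    · obtain ⟨a, ha⟩ := mem_iUnion.1 (hvu.symm ▸ mem_univ x : x ∈ ⋃ i, v i)
      obtain ⟨y, hya, hy⟩ := mem_closure_iff.1 hx (v a) (hvo a) ha
      obtain ⟨n, hn⟩ := mem_iUnion.1 hy
      exact hsub n a ⟨y, hya, hn⟩ ha
    · obtain ⟨a, ha⟩ := mem_iUnion.1 (hvu.symm ▸ mem_univ x : x ∈ ⋃ i, v i)
      obtain ⟨n, hn⟩ := mem_iUnion.1 hx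
      exact mem_of_superset ((hvo a).mem_nhds ha) (hsub n a ⟨x, ha, hn⟩)
  have huniv := hclopen.eq_univ ⟨x₀, mem_iUnion.2 ⟨0, rfl⟩⟩
  exact SigmaCompactSpace_iff_exists_compact_covering.2 ⟨C, hC, huniv⟩

noncomputable section

section LieBundle

variable {K : Type*} [RCLike K]
  {E : Type*} [NormedAddCommGroup E] [NormedSpace ℝ E]
  {M : Type*} [TopologicalSpace M] [ChartedSpace E M]
  {𝔨 : Type*} [NormedLieRing 𝔨] [NormedSpace ℝ 𝔨] [LieAlgebra K 𝔨]
  {L : M → Type*} [∀ x, LieRing (L x)] [∀ x, LieAlgebra K (L x)]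
  [TopologicalSpace (TotalSpace 𝔨 L)] [∀ x, TopologicalSpace (L x)] [FiberBundle 𝔨 L]

/-! ### Smooth functions with values in `K` -/

/-- A real-valued smooth function as a `K`-valued one. -/
def ofRealFun (K : Type*) [RCLike K] (f : C^∞⟮𝓘(ℝ, E), M; 𝓘(ℝ, ℝ), ℝ⟯) :
    C^∞⟮𝓘(ℝ, E), M; 𝓘(ℝ, K), K⟯ :=
  ⟨fun x => (f x : K), (RCLike.ofRealCLM (K := K)).contMDiff.comp f.contMDiff⟩

@[simp]
theorem ofRealFun_apply (f : C^∞⟮𝓘(ℝ, E), M; 𝓘(ℝ, ℝ), ℝ⟯) (x : M) :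
    ofRealFun K f x = (f x : K) := rfl

theorem tsupport_ofRealFun_subset (f : C^∞⟮𝓘(ℝ, E), M; 𝓘(ℝ, ℝ), ℝ⟯) :
    tsupport (ofRealFun K f) ⊆ tsupport f := by
  refine closure_mono fun x hx => ?_
  simp only [Function.mem_support, ofRealFun_apply, ne_eq, RCLike.ofReal_eq_zero] at hx ⊢
  exact hx

theorem exists_cutoff_rclike (K : Type*) [RCLike K] [FiniteDimensional ℝ E]
    [IsManifold 𝓘(ℝ, E) ∞ M] [T2Space M] (x : M) {U : Set M} (hU : U ∈ 𝓝 x) :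
    ∃ ψ : C^∞⟮𝓘(ℝ, E), M; 𝓘(ℝ, K), K⟯, tsupport ψ ⊆ U ∧ ∀ᶠ y in 𝓝 x, ψ y = 1 := by
  obtain ⟨ψ, h1, h2⟩ := LieConnection.exists_cutoff (E := E) x hU
  refine ⟨ofRealFun K ψ, (tsupport_ofRealFun_subset ψ).trans h1, ?_⟩
  filter_upwards [h2] with y hy
  simp [hy]

/-- The extension by zero of a smooth function, cut off by a smooth function. -/
def cutoffMul {V : Type*} [NormedAddCommGroup V] [NormedSpace ℝ V] [Module K V]
    [IsScalarTower ℝ K V] [FiniteDimensional ℝ V] {U : Set M} (hU : IsOpen U)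
    (ψ : C^∞⟮𝓘(ℝ, E), M; 𝓘(ℝ, K), K⟯) (hψ : tsupport ψ ⊆ U)
    (w : M → V) (hw : ContMDiffOn 𝓘(ℝ, E) 𝓘(ℝ, V) ∞ w U) : C^∞⟮𝓘(ℝ, E), M; 𝓘(ℝ, V), V⟯ :=
  ⟨fun y => ψ y • w y, contMDiff_of_tsupport fun x hx =>
    contMDiffAt_bilin (LinearMap.mk₂ ℝ (fun (c : K) (v : V) => c • v) (fun _ _ _ => add_smul _ _ _)
      (fun _ _ _ => smul_assoc _ _ _) (fun _ _ _ => smul_add _ _ _)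
      (fun c v w => (smul_comm c v w).symm)) (ψ.contMDiff x)
      (hw.contMDiffAt (hU.mem_nhds (hψ (closure_mono (fun z hz => by
        rw [Function.mem_support] at hz ⊢
        exact fun h0 => hz (by rw [h0, zero_smul])) hx))))⟩

theorem tsupport_cutoffMul_subset {V : Type*} [NormedAddCommGroup V] [NormedSpace ℝ V] [Module K V]
    [IsScalarTower ℝ K V] [FiniteDimensional ℝ V] {U : Set M} (hU : IsOpen U)
    (ψ : C^∞⟮𝓘(ℝ, E), M; 𝓘(ℝ, K), K⟯) (hψ : tsupport ψ ⊆ U)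
    (w : M → V) (hw : ContMDiffOn 𝓘(ℝ, E) 𝓘(ℝ, V) ∞ w U) :
    tsupport (cutoffMul hU ψ hψ w hw) ⊆ tsupport ψ :=
  closure_mono fun z hz h0 => hz (by
    change ψ z • w z = 0
    rw [h0, zero_smul])

/-! ### Bundle charts -/

namespace IsLieBundleChart

variable {e : Trivialization 𝔨 (TotalSpace.proj : TotalSpace 𝔨 L → M)}

theorem exists_lieEquiv_symm (he : IsLieBundleChart K E e) {y : M} (hy : y ∈ e.baseSet) :
    ∃ φ : L y ≃ₗ⁅K⁆ 𝔨, (∀ v : L y, (e ⟨y, v⟩).2 = φ v) ∧ ∀ v : 𝔨, e.symm y v = φ.symm v := by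
  obtain ⟨φ, hφ⟩ := he.exists_lieEquiv y hy
  refine ⟨φ, hφ, fun v => ?_⟩
  apply φ.injective
  change φ (e.symm y v) = φ (φ.symm v)
  rw [← hφ, LieEquiv.apply_symm_apply,
    show (⟨y, e.symm y v⟩ : TotalSpace 𝔨 L) = _ from e.mk_symm hy v]
  exact congrArg Prod.snd (e.toOpenPartialHomeomorph.right_inv (x := (y, v)) (by
    change (y, v) ∈ e.target
    rw [e.mem_target]; exact hy))

theorem apply_symm (he : IsLieBundleChart K E e) {y : M} (hy : y ∈ e.baseSet) (v : 𝔨) :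
    (e ⟨y, e.symm y v⟩).2 = v := by
  obtain ⟨φ, h1, h2⟩ := he.exists_lieEquiv_symm hy
  rw [h1, h2]
  exact φ.apply_symm_apply v

theorem symm_apply (he : IsLieBundleChart K E e) {y : M} (hy : y ∈ e.baseSet) (v : L y) :
    e.symm y (e ⟨y, v⟩).2 = v := by
  obtain ⟨φ, h1, h2⟩ := he.exists_lieEquiv_symm hy
  rw [h1, h2]
  exact φ.symm_apply_apply v

theorem symm_smul (he : IsLieBundleChart K E e) {y : M} (hy : y ∈ e.baseSet) (c : K) (v : 𝔨) :
    e.symm y (c • v) = c • e.symm y v := by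
  obtain ⟨φ, h1, h2⟩ := he.exists_lieEquiv_symm hy
  rw [h2, h2]
  exact _root_.map_smul φ.symm c v

theorem symm_lie (he : IsLieBundleChart K E e) {y : M} (hy : y ∈ e.baseSet) (v w : 𝔨) :
    e.symm y ⁅v, w⁆ = ⁅e.symm y v, e.symm y w⁆ := by
  obtain ⟨φ, h1, h2⟩ := he.exists_lieEquiv_symm hy
  rw [h2, h2, h2]
  exact LieEquiv.map_lie φ.symm v w

theorem symm_sum (he : IsLieBundleChart K E e) {y : M} (hy : y ∈ e.baseSet) {ι : Type*}
    (s : Finset ι) (v : ι → 𝔨) : e.symm y (∑ i ∈ s, v i) = ∑ i ∈ s, e.symm y (v i) := by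
  obtain ⟨φ, h1, h2⟩ := he.exists_lieEquiv_symm hy
  simp only [h2]
  exact _root_.map_sum φ.symm _ _

end IsLieBundleChart

variable [IsScalarTower ℝ K 𝔨] [FiniteDimensional K 𝔨] [IsLieAlgebraBundle K E 𝔨 L]

/-! ### Smooth sections -/

theorem lieSections_ext {A B : lieSections K E 𝔨 L} (h : ∀ x, A.1 x = B.1 x) : A = B :=
  Subtype.ext (funext h)

theorem lieSections_sum_apply {ι : Type*} (s : Finset ι) (A : ι → lieSections K E 𝔨 L) (x : M) :
    (∑ i ∈ s, A i).1 x = ∑ i ∈ s, (A i).1 x := by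
  classical
  induction s using Finset.induction_on with
  | empty => rfl
  | insert i s hi ih =>
    rw [Finset.sum_insert hi, Finset.sum_insert hi, ← ih]
    rfl

namespace IsLieBundleChart

variable {e : Trivialization 𝔨 (TotalSpace.proj : TotalSpace 𝔨 L → M)}

open scoped Classical in
/-- The global section which is `w` in a bundle chart, for `w` supported in the base set. -/
def localSection (he : IsLieBundleChart K E e) (w : C^∞⟮𝓘(ℝ, E), M; 𝓘(ℝ, 𝔨), 𝔨⟯)
    (hw : tsupport w ⊆ e.baseSet) : lieSections K E 𝔨 L :=
  ⟨fun y => if y ∈ e.baseSet then e.symm y (w y) else 0, fun x => by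
    by_cases hx : x ∈ e.baseSet
    · refine (he.contMDiffAt_section_iff
        (A := fun y => if y ∈ e.baseSet then e.symm y (w y) else 0) hx).2
        ((w.contMDiff x).congr_of_eventuallyEq ?_)
      filter_upwards [e.open_baseSet.mem_nhds hx] with y hy
      rw [if_pos hy, he.apply_symm hy]
    -- Outside the base set the point `x` is off the closed support of `w`, so the section vanishes
    -- near `x`.
    · refine ((0 : lieSections K E 𝔨 L).2 x).congr_of_eventuallyEq ?_
      filter_upwards [(isClosed_tsupport w).isOpen_compl.mem_nhds (fun h => hx (hw h))] with y hy
      congr 1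
      split_ifs with h
      · rw [image_eq_zero_of_notMem_tsupport hy]
        obtain ⟨φ, h1, h2⟩ := he.exists_lieEquiv_symm h
        rw [h2]
        exact _root_.map_zero φ.symm
      · rfl⟩

theorem localSection_apply (he : IsLieBundleChart K E e) (w : C^∞⟮𝓘(ℝ, E), M; 𝓘(ℝ, 𝔨), 𝔨⟯)
    (hw : tsupport w ⊆ e.baseSet) {y : M} (hy : y ∈ e.baseSet) :
    (he.localSection w hw).1 y = e.symm y (w y) := if_pos hy

theorem localSection_apply_of_eq_zero (he : IsLieBundleChart K E e)
    (w : C^∞⟮𝓘(ℝ, E), M; 𝓘(ℝ, 𝔨), 𝔨⟯) (hw : tsupport w ⊆ e.baseSet) {y : M} (hy : w y = 0) :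
    (he.localSection w hw).1 y = 0 := by
  by_cases h : y ∈ e.baseSet
  · obtain ⟨φ, h1, h2⟩ := he.exists_lieEquiv_symm h
    rw [he.localSection_apply w hw h, hy, h2]
    exact _root_.map_zero φ.symm
  · exact if_neg h

theorem contMDiffOn_map {V : Type*} [NormedAddCommGroup V] [NormedSpace ℝ V]
    (he : IsLieBundleChart K E e) (A : lieSections K E 𝔨 L) (l : 𝔨 →ₗ[ℝ] V) :
    ContMDiffOn 𝓘(ℝ, E) 𝓘(ℝ, V) ∞ (fun y => l (e ⟨y, A.1 y⟩).2) e.baseSet := by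
  have := finiteDimensional_real K 𝔨
  intro x hx
  have h1 : ContMDiff 𝓘(ℝ, 𝔨) 𝓘(ℝ, V) ∞ l := (LinearMap.toContinuousLinearMap l).contMDiff
  exact (ContMDiffAt.comp x (h1 _) ((he.contMDiffAt_section_iff hx).1 (A.2 x))).contMDiffWithinAt

end IsLieBundleChart

/-! ### Endomorphisms of `Γ(L)` linear over the smooth functions -/

section Tensorial

variable (K) in
/-- Linearity over the smooth functions. -/
def IsFunLinear (T : lieSections K E 𝔨 L →ₗ[K] lieSections K E 𝔨 L) : Prop :=
  ∀ (a : C^∞⟮𝓘(ℝ, E), M; 𝓘(ℝ, K), K⟯) (A : lieSections K E 𝔨 L),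
    T (funSmulSection a A) = funSmulSection a (T A)

/-- Linearity over the real smooth functions implies linearity over the `K`-valued ones. -/
theorem isFunLinear_of_real {T : lieSections K E 𝔨 L →ₗ[K] lieSections K E 𝔨 L}
    (hT : ∀ (f : C^∞⟮𝓘(ℝ, E), M; 𝓘(ℝ, ℝ), ℝ⟯) (A : lieSections K E 𝔨 L),
      T (funSmulSection (ofRealFun K f) A) = funSmulSection (ofRealFun K f) (T A)) :
    IsFunLinear K T := by
  intro a A
  let f : C^∞⟮𝓘(ℝ, E), M; 𝓘(ℝ, ℝ), ℝ⟯ :=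
    ⟨fun x => RCLike.re (a x), (RCLike.reCLM (K := K)).contMDiff.comp a.contMDiff⟩
  let g : C^∞⟮𝓘(ℝ, E), M; 𝓘(ℝ, ℝ), ℝ⟯ :=
    ⟨fun x => RCLike.im (a x), (RCLike.imCLM (K := K)).contMDiff.comp a.contMDiff⟩
  have key : ∀ B : lieSections K E 𝔨 L, funSmulSection a B =
      funSmulSection (ofRealFun K f) B +
        (RCLike.I : K) • funSmulSection (ofRealFun K g) B := by
    intro B
    refine lieSections_ext fun x => ?_
    change a x • B.1 x = ((RCLike.re (a x) : ℝ) : K) • B.1 x +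
      (RCLike.I : K) • ((RCLike.im (a x) : ℝ) : K) • B.1 x
    rw [smul_smul, ← add_smul, mul_comm, RCLike.re_add_im]
  rw [key, key, _root_.map_add, _root_.map_smul, hT, hT]

variable [FiniteDimensional ℝ E] [IsManifold 𝓘(ℝ, E) ∞ M] [T2Space M]

/-- A section can be prescribed to be constant in a bundle chart near a given point. -/
theorem IsLieBundleChart.exists_section_eq
    {e : Trivialization 𝔨 (TotalSpace.proj : TotalSpace 𝔨 L → M)}
    (he : IsLieBundleChart K E e) {x : M} (hx : x ∈ e.baseSet) (v : 𝔨) :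
    ∃ A : lieSections K E 𝔨 L, ∀ᶠ y in 𝓝 x, A.1 y = e.symm y v := by
  have := finiteDimensional_real K 𝔨
  obtain ⟨ψ, h1, h2⟩ := exists_cutoff_rclike (E := E) K x (e.open_baseSet.mem_nhds hx)
  refine ⟨he.localSection (cutoffMul e.open_baseSet ψ h1 (fun _ => v) contMDiffOn_const)
    ((tsupport_cutoffMul_subset _ _ _ _ _).trans h1), ?_⟩
  filter_upwards [h2, e.open_baseSet.mem_nhds hx] with y hy hye
  rw [he.localSection_apply _ _ hye]
  change e.symm y (ψ y • v) = _
  rw [hy, one_smul]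

theorem exists_section_apply_eq (x : M) (v : L x) : ∃ A : lieSections K E 𝔨 L, A.1 x = v := by
  obtain ⟨e, hx, he⟩ := IsLieAlgebraBundle.exists_chart (K := K) (E := E) (𝔨 := 𝔨) (L := L) x
  obtain ⟨A, hA⟩ := he.exists_section_eq hx (e ⟨x, v⟩).2
  exact ⟨A, by rw [hA.self_of_nhds, he.symm_apply hx]⟩

/-- A family of endomorphisms of the fibres which maps smooth sections to smooth sections is
smooth. -/
theorem isSmoothEndOn_of_forall {T : ∀ x, Module.End K (L x)} {U : Set M}
    (hT : ∀ (A : lieSections K E 𝔨 L), ∀ x ∈ U, ContMDiffAt 𝓘(ℝ, E) (𝓘(ℝ, E).prod 𝓘(ℝ, 𝔨)) ∞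
      (fun y => TotalSpace.mk' 𝔨 y (T y (A.1 y))) x) : IsSmoothEndOn K E 𝔨 L T U := by
  intro e he v x hx
  obtain ⟨A, hA⟩ := he.exists_section_eq hx.1 v
  refine ContMDiffAt.contMDiffWithinAt ?_
  refine ((he.contMDiffAt_section_iff (A := fun y => T y (A.1 y)) hx.1).1
    (hT A x hx.2)).congr_of_eventuallyEq ?_
  filter_upwards [hA] with y hy
  rw [hy]

/-- With a cut-off `ψ` equal to 1 near `x`, the section `ψ²A` is a combination of global sections
whose coefficient functions vanish at `x`. One factor `ψ` globalises the coefficients, the other the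
local frame. -/
theorem IsFunLinear.apply_eq_zero {T : lieSections K E 𝔨 L →ₗ[K] lieSections K E 𝔨 L}
    (hT : IsFunLinear K T) {A : lieSections K E 𝔨 L} {x : M} (hA : A.1 x = 0) :
    (T A).1 x = 0 := by
  have := finiteDimensional_real K 𝔨
  obtain ⟨e, hx, he⟩ := IsLieAlgebraBundle.exists_chart (K := K) (E := E) (𝔨 := 𝔨) (L := L) x
  obtain ⟨ψ, h1, h2⟩ := exists_cutoff_rclike (E := E) K x (e.open_baseSet.mem_nhds hx)
  let b := Module.finBasis K 𝔨
  let a : Fin (Module.finrank K 𝔨) → C^∞⟮𝓘(ℝ, E), M; 𝓘(ℝ, K), K⟯ := fun i =>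
    cutoffMul e.open_baseSet ψ h1 _ (he.contMDiffOn_map A ((b.coord i).restrictScalars ℝ))
  let S : Fin (Module.finrank K 𝔨) → lieSections K E 𝔨 L := fun i =>
    he.localSection (cutoffMul e.open_baseSet ψ h1 (fun _ => b i) contMDiffOn_const)
    ((tsupport_cutoffMul_subset _ _ _ _ _).trans h1)
  have hsum : funSmulSection ψ (funSmulSection ψ A) = ∑ i, funSmulSection (a i) (S i) := by
    refine lieSections_ext fun y => ?_
    rw [lieSections_sum_apply]
    change ψ y • ψ y • A.1 y = ∑ i, (ψ y • b.coord i (e ⟨y, A.1 y⟩).2) • (S i).1 y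
    by_cases hy : y ∈ e.baseSet
    · have hS : ∀ i, (S i).1 y = ψ y • e.symm y (b i) := fun i => by
        rw [he.localSection_apply _ _ hy]
        exact he.symm_smul hy _ _
      conv_lhs => rw [← he.symm_apply hy (A.1 y), ← b.sum_repr (e ⟨y, A.1 y⟩).2, he.symm_sum hy]
      simp only [hS, he.symm_smul hy, Finset.smul_sum, smul_smul, Module.Basis.coord_apply,
        smul_eq_mul]
      refine Finset.sum_congr rfl fun i _ => ?_
      congr 1
      ring
    · have : ψ y = 0 := image_eq_zero_of_notMem_tsupport fun h => hy (h1 h)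
      simp [this]
  have h3 := congrArg (fun B => (T B).1 x) hsum
  simp only [hT _ _, _root_.map_sum, lieSections_sum_apply] at h3
  have h4 : (T A).1 x = ψ x • ψ x • (T A).1 x := by rw [h2.self_of_nhds, one_smul, one_smul]
  rw [h4]
  refine h3.trans (Finset.sum_eq_zero fun i _ => ?_)
  change (ψ x • b.coord i (e ⟨x, A.1 x⟩).2) • (T (S i)).1 x = 0
  rw [hA, he.map_zero hx, _root_.map_zero, smul_zero, zero_smul]

theorem IsFunLinear.apply_congr {T : lieSections K E 𝔨 L →ₗ[K] lieSections K E 𝔨 L}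
    (hT : IsFunLinear K T) {A B : lieSections K E 𝔨 L} {x : M} (h : A.1 x = B.1 x) :
    (T A).1 x = (T B).1 x := by
  have := hT.apply_eq_zero (A := A - B) (x := x) (sub_eq_zero.2 h)
  rw [_root_.map_sub] at this
  exact sub_eq_zero.1 this

/-- The endomorphism of a fibre induced by a function-linear endomorphism of `Γ(L)`. -/
def IsFunLinear.fiberMap {T : lieSections K E 𝔨 L →ₗ[K] lieSections K E 𝔨 L}
    (hT : IsFunLinear K T) (x : M) : Module.End K (L x) where
  toFun v := (T (exists_section_apply_eq x v).choose).1 x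
  map_add' v w := by
    rw [hT.apply_congr (B := (exists_section_apply_eq x v).choose +
      (exists_section_apply_eq x w).choose), _root_.map_add]
    · rfl
    · rw [(exists_section_apply_eq x (v + w)).choose_spec]
      exact (congrArg₂ (· + ·) (exists_section_apply_eq x v).choose_spec
        (exists_section_apply_eq x w).choose_spec).symm
  map_smul' c v := by
    rw [hT.apply_congr (B := c • (exists_section_apply_eq x v).choose), _root_.map_smul]
    · rfl
    · rw [(exists_section_apply_eq x (c • v)).choose_spec]
      exact (congrArg (c • ·) (exists_section_apply_eq x v).choose_spec).symm

theorem IsFunLinear.fiberMap_apply {T : lieSections K E 𝔨 L →ₗ[K] lieSections K E 𝔨 L}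
    (hT : IsFunLinear K T) (x : M) (A : lieSections K E 𝔨 L) :
    hT.fiberMap x (A.1 x) = (T A).1 x :=
  hT.apply_congr (exists_section_apply_eq x (A.1 x)).choose_spec

/-- A function-linear derivation of `Γ(L)` comes from a section of `Der(L)`. -/
theorem IsFunLinear.exists_derSection {T : lieSections K E 𝔨 L →ₗ[K] lieSections K E 𝔨 L}
    (hT : IsFunLinear K T) (hD : ∀ A B : lieSections K E 𝔨 L, T ⁅A, B⁆ = ⁅T A, B⁆ + ⁅A, T B⁆) :
    ∃ D₀ : DerSection K E 𝔨 L, T = D₀.incl := by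
  refine ⟨⟨fun x => ⟨hT.fiberMap x, fun v w => ?_⟩, isSmoothEndOn_of_forall fun A x _ => ?_⟩, ?_⟩
  · obtain ⟨A, rfl⟩ := exists_section_apply_eq (K := K) (E := E) (𝔨 := 𝔨) x v
    obtain ⟨B, rfl⟩ := exists_section_apply_eq (K := K) (E := E) (𝔨 := 𝔨) x w
    change hT.fiberMap x ((⁅A, B⁆ : lieSections K E 𝔨 L).1 x) = _
    -- `LieDerivation` has the Leibniz rule in the form `D[v, w] = [v, Dw] - [w, Dv]`, hence the
    -- change of sign.
    rw [hT.fiberMap_apply, hT.fiberMap_apply, hT.fiberMap_apply, hD, ← lie_skew (B.1 x)]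
    rw [sub_neg_eq_add, add_comm]
    rfl
  · refine ((T A).2 x).congr_of_eventuallyEq (Eventually.of_forall fun y => ?_)
    change TotalSpace.mk' 𝔨 y (hT.fiberMap y (A.1 y)) = _
    rw [hT.fiberMap_apply]
  · ext A x
    exact (hT.fiberMap_apply x A).symm

end Tensorial

end LieBundle

end

/-! ### Coloured covers of noncompact manifolds, and perfect Lie algebras -/

noncomputable section

/-- A connected paracompact manifold has a locally finite cover subordinate to a given neighbourhood
assignment which consists of finitely many families of pairwise disjoint sets. -/
theorem exists_locallyFinite_colorCover.{u, v} (E : Type u) [NormedAddCommGroup E] [NormedSpace ℝ E]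
    [FiniteDimensional ℝ E] {M : Type v} [TopologicalSpace M] [ChartedSpace E M] [T2Space M]
    [SigmaCompactSpace M] (U : M → Set M) (hU : ∀ x, U x ∈ 𝓝 x) :
    ∃ (N : ℕ) (ι : Type v) (col : ι → Fin 3 × Fin N) (C : ι → Set M),
      (∀ i, IsClosed (C i)) ∧ (∀ i, ∃ x, C i ⊆ U x) ∧ LocallyFinite C ∧
      (∀ i j, i ≠ j → col i = col j → Disjoint (C i) (C j)) ∧ ⋃ i, interior (C i) = univ := by
  classical
  have : LocallyCompactSpace M := ChartedSpace.locallyCompactSpace E M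
  obtain ⟨N, hN⟩ := exists_hasColorCover_of_isCompact E M
  -- The double shift makes the stages 0 and 1 empty, so every point first appears at a stage `m +
  -- 2` and lies in the shell `S m`.
  let K : CompactExhaustion M := (CompactExhaustion.choice M).shiftr.shiftr
  have hK1 : K 1 = ∅ := rfl
  let S : ℕ → Set M := fun m => K (m + 2) \ interior (K (m + 1))
  let O : ℕ → Set M := fun m => interior (K (m + 3)) \ K m
  have hO : ∀ m, IsOpen (O m) := fun m => isOpen_interior.sdiff (K.isCompact m).isClosed
  have hS : ∀ m, IsCompact (S m) := fun m => (K.isCompact _).diff isOpen_interior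
  have hSO : ∀ m, S m ⊆ O m := fun m x hx =>
    ⟨K.subset_interior_succ _ hx.1, fun h => hx.2 (K.subset_interior_succ _ h)⟩
  have hcovS : ∀ x, ∃ m, x ∈ S m := by
    intro x
    have h0 : ¬ K.find x ≤ 1 := fun h => by
      have := K.mem_iff_find_le.2 h
      rw [hK1] at this
      exact this
    obtain ⟨m, hm⟩ : ∃ m, K.find x = m + 2 := ⟨K.find x - 2, by omega⟩
    refine ⟨m, hm ▸ K.mem_find x, fun h => ?_⟩
    have := K.mem_iff_find_le.1 (interior_subset h)
    omega
  have hOdisj : ∀ m m', m + 3 ≤ m' → Disjoint (O m) (O m') := fun m m' h =>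
    disjoint_left.2 fun x hx hx' => hx'.2 (K.subset h (interior_subset hx.1))
  -- A subset of `W m x` that meets the shell `S m` must lie in `O m`: the case `x ∉ O m` excludes
  -- `S m`.
  let W : ℕ → M → Set M := fun m x => U x ∩ if x ∈ O m then O m else (S m)ᶜ
  have hW : ∀ m x, W m x ∈ 𝓝 x := by
    intro m x
    refine inter_mem (hU x) ?_
    split_ifs with h
    · exact (hO m).mem_nhds h
    · exact (hS m).isClosed.isOpen_compl.mem_nhds fun h' => h (hSO m h')
  choose F hfin hF hdisj hcov using fun m => hN (S m) (hS m) (W m) (hW m)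
  let ι := {q : ℕ × Fin N × Set M // q.2.2 ∈ F q.1 q.2.1 ∧ q.2.2 ⊆ O q.1}
  -- `O m` and `O m'` are disjoint once the indices differ by at least 3, so recording the shell
  -- modulo 3 separates different shells of the same colour.
  refine ⟨N, ι, fun q => (⟨q.1.1 % 3, Nat.mod_lt _ (by norm_num)⟩, q.1.2.1), fun q => q.1.2.2,
    fun q => (hF _ _ _ q.2.1).1, fun q => ?_, fun x => ?_, ?_, ?_⟩
  · obtain ⟨-, x, hx⟩ := hF _ _ _ q.2.1
    exact ⟨x, fun y hy => (hx hy).1⟩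
  -- This neighbourhood is disjoint from `O m` for `m ≥ K.find x + 1`, so only finitely many shells
  -- contribute.
  · refine ⟨K (K.find x + 1), mem_interior_iff_mem_nhds.1 (K.subset_interior_succ _ (K.mem_find x)),
      ?_⟩
    have h1 : (⋃ m ∈ Iio (K.find x + 1), ⋃ c,
        (fun C => ((m, c, C) : ℕ × Fin N × Set M)) '' F m c).Finite :=
      (finite_Iio _).biUnion fun m _ => finite_iUnion fun c => (hfin m c).image _
    refine (h1.preimage Subtype.val_injective.injOn).subset ?_
    rintro ⟨⟨m, c, C⟩, hC, hCO⟩ ⟨y, hy, hyK⟩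
    refine mem_iUnion₂.2 ⟨m, ?_, mem_iUnion.2 ⟨c, C, hC, rfl⟩⟩
    by_contra hm
    exact (hCO hy).2 (K.subset (not_lt.1 hm) hyK)
  · rintro ⟨⟨m, c, C⟩, hC, hCO⟩ ⟨⟨m', c', C'⟩, hC', hCO'⟩ hne hcol
    simp only [Prod.mk.injEq, Fin.mk.injEq] at hcol
    obtain ⟨hmod, rfl⟩ := hcol
    by_cases hmm : m = m'
    · subst hmm
      exact hdisj m c hC hC' (fun h => hne (by subst h; rfl))
    · rcases lt_or_gt_of_ne hmm with h | h
      · exact (hOdisj m m' (by omega)).mono hCO hCO'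
      · exact (hOdisj m' m (by omega)).symm.mono hCO hCO'
  · refine iUnion_eq_univ_iff.2 fun y => ?_
    obtain ⟨m, hm⟩ := hcovS y
    obtain ⟨c, C, hC, hy⟩ := hcov m y hm
    refine ⟨⟨(m, c, C), hC, ?_⟩, hy⟩
    obtain ⟨-, x, hx⟩ := hF m c C hC
    by_cases hxO : x ∈ O m
    · intro z hz
      have := (hx hz).2
      rwa [if_pos hxO] at this
    · have := (hx (interior_subset hy)).2
      rw [if_neg hxO] at this
      exact (this hm).elim

/-- In a perfect finite-dimensional Lie algebra, every element is a finite sum of brackets, with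
factors which depend linearly on the element. -/
theorem IsPerfectLie.exists_eq_sum_lie {K 𝔤 : Type*} [Field K] [LieRing 𝔤] [LieAlgebra K 𝔤]
    [FiniteDimensional K 𝔤] (h : IsPerfectLie K 𝔤) :
    ∃ (n : ℕ) (l : Fin n → 𝔤 →ₗ[K] 𝔤) (v : Fin n → 𝔤), ∀ w, w = ∑ p, ⁅l p w, v p⁆ := by
  -- The claim says that the identity lies in the span of these maps. The identity is a sum of
  -- rank-one maps `α ⊗ z`, perfectness makes `z` a combination of brackets, and `α ⊗ [x, n]` is the
  -- map `w ↦ [α(w)x, n]`.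
  let s : Set (Module.End K 𝔤) := {g | ∃ (l : 𝔤 →ₗ[K] 𝔤) (v : 𝔤), ∀ w, g w = ⁅l w, v⁆}
  have hs : ∀ (α : 𝔤 →ₗ[K] K) (z : 𝔤), α.smulRight z ∈ Submodule.span K s := by
    intro α z
    have hz : z ∈ Submodule.span K
        {m | ∃ x : (⊤ : LieIdeal K 𝔤), ∃ n : (⊤ : LieIdeal K 𝔤), ⁅(x : 𝔤), (n : 𝔤)⁆ = m} := by
      rw [← LieSubmodule.lieIdeal_oper_eq_linear_span,
        show ⁅(⊤ : LieIdeal K 𝔤), (⊤ : LieIdeal K 𝔤)⁆ = ⊤ from h]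
      trivial
    induction hz using Submodule.span_induction with
    | mem z hz =>
      obtain ⟨x, n, rfl⟩ := hz
      exact Submodule.subset_span ⟨α.smulRight (x : 𝔤), n, fun w => by simp⟩
    | zero => simp
    | add y z _ _ hy hz =>
      convert Submodule.add_mem _ hy hz using 1
      ext w
      simp
    | smul c z _ hz =>
      convert Submodule.smul_mem _ c hz using 1
      ext w
      simp [smul_comm c]
  have hid : (LinearMap.id : Module.End K 𝔤) ∈ Submodule.span K s := by
    let b := Module.finBasis K 𝔤
    have : (LinearMap.id : Module.End K 𝔤) = ∑ i, (b.coord i).smulRight (b i) := by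
      ext w
      simp [b.sum_repr]
    rw [this]
    exact Submodule.sum_mem _ fun i _ => hs _ _
  obtain ⟨n, c, g, hg⟩ := Submodule.mem_span_set'.1 hid
  choose l v hlv using fun p => (g p).2
  refine ⟨n, fun p => c p • l p, v, fun w => ?_⟩
  conv_lhs => rw [← LinearMap.id_apply (R := K) w, ← hg]
  simp [hlv]

/-! ### Sections of a bundle with perfect fibre are sums of brackets -/

section LieBundle

variable {K : Type*} [RCLike K]
  {E : Type*} [NormedAddCommGroup E] [NormedSpace ℝ E]
  {M : Type*} [TopologicalSpace M] [ChartedSpace E M]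
  {𝔨 : Type*} [NormedLieRing 𝔨] [NormedSpace ℝ 𝔨] [LieAlgebra K 𝔨]
  {L : M → Type*} [∀ x, LieRing (L x)] [∀ x, LieAlgebra K (L x)]
  [TopologicalSpace (TotalSpace 𝔨 L)] [∀ x, TopologicalSpace (L x)] [FiberBundle 𝔨 L]
  [IsScalarTower ℝ K 𝔨] [FiniteDimensional K 𝔨] [IsLieAlgebraBundle K E 𝔨 L]

/-- A sum of smooth sections with locally finite supports. -/
def locallyFiniteSum {ι : Type*} (B : ι → lieSections K E 𝔨 L) {C : ι → Set M}
    (hC : LocallyFinite C) (hB : ∀ i, ∀ y ∉ C i, (B i).1 y = 0) : lieSections K E 𝔨 L :=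
  ⟨fun y => ∑ᶠ i, (B i).1 y, fun x => by
    obtain ⟨V, hV, hfin⟩ := hC x
    refine ((∑ i ∈ hfin.toFinset, B i : lieSections K E 𝔨 L).2 x).congr_of_eventuallyEq ?_
    filter_upwards [hV] with y hy
    rw [lieSections_sum_apply, finsum_eq_sum_of_support_subset]
    intro i hi
    rw [Finite.coe_toFinset]
    exact ⟨y, by_contra fun h => hi (hB i y h), hy⟩⟩

theorem locallyFiniteSum_apply {ι : Type*} (B : ι → lieSections K E 𝔨 L) {C : ι → Set M}
    (hC : LocallyFinite C) (hB : ∀ i, ∀ y ∉ C i, (B i).1 y = 0) (y : M) :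
    (locallyFiniteSum B hC hB).1 y = ∑ᶠ i, (B i).1 y := rfl

variable [FiniteDimensional ℝ E] [IsManifold 𝓘(ℝ, E) ∞ M] [T2Space M] [SigmaCompactSpace M]

/-- If the typical fibre is perfect, then every smooth section is a finite sum of brackets. -/
theorem mem_span_lie_of_isPerfectLie (h𝔨 : IsPerfectLie K 𝔨) (A : lieSections K E 𝔨 L) :
    A ∈ Submodule.span K {B : lieSections K E 𝔨 L | ∃ P Q : lieSections K E 𝔨 L, ⁅P, Q⁆ = B} := by
  classical
  have := finiteDimensional_real K 𝔨
  have : LocallyCompactSpace M := ChartedSpace.locallyCompactSpace E M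
  obtain ⟨n, l, v, hlv⟩ := h𝔨.exists_eq_sum_lie
  choose e hxe he using fun x : M =>
    IsLieAlgebraBundle.exists_chart (K := K) (E := E) (𝔨 := 𝔨) (L := L) x
  obtain ⟨N, ι, col, C, hCc, hCe, hCf, hCd, hCu⟩ := exists_locallyFinite_colorCover E
    (fun x => (e x).baseSet) (fun x => (e x).open_baseSet.mem_nhds (hxe x))
  choose c hc using hCe
  obtain ⟨ρ, hρ⟩ := SmoothPartitionOfUnity.exists_isSubordinate 𝓘(ℝ, E) isClosed_univ
    (fun i => interior (C i)) (fun _ => isOpen_interior) (by rw [hCu])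
  -- `f i` is 1 near the support of `ρ i`, so `ρ i * f i = ρ i`. One factor of each local bracket
  -- carries `ρ i` and the other `f i`, and the brackets sum to `ρ i • A`.
  choose f hf1 hf0 _ using fun i => exists_contMDiffMap_one_nhds_of_subset_interior 𝓘(ℝ, E) (n := ⊤)
    (isClosed_tsupport (ρ i)) (hρ i)
  have hft : ∀ i, tsupport (ofRealFun K (f i)) ⊆ C i := fun i =>
    (tsupport_ofRealFun_subset _).trans (closure_minimal
      (fun y hy => by_contra fun h => hy (hf0 i y h)) (hCc i))
  have hρt : ∀ i, tsupport (ofRealFun K (ρ i)) ⊆ C i := fun i =>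
    (tsupport_ofRealFun_subset _).trans ((hρ i).trans interior_subset)
  have hfb := fun i => (hft i).trans (hc i)
  have hρb := fun i => (hρt i).trans (hc i)
  let wP : Fin n → ι → C^∞⟮𝓘(ℝ, E), M; 𝓘(ℝ, 𝔨), 𝔨⟯ := fun p i =>
    cutoffMul (e (c i)).open_baseSet (ofRealFun K (ρ i)) (hρb i) _
      ((he (c i)).contMDiffOn_map A ((l p).restrictScalars ℝ))
  let wQ : Fin n → ι → C^∞⟮𝓘(ℝ, E), M; 𝓘(ℝ, 𝔨), 𝔨⟯ := fun p i =>
    cutoffMul (e (c i)).open_baseSet (ofRealFun K (f i)) (hfb i) (fun _ => v p) contMDiffOn_const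
  let P : Fin n → ι → lieSections K E 𝔨 L := fun p i =>
    (he (c i)).localSection (wP p i) ((tsupport_cutoffMul_subset _ _ _ _ _).trans (hρb i))
  let Q : Fin n → ι → lieSections K E 𝔨 L := fun p i =>
    (he (c i)).localSection (wQ p i) ((tsupport_cutoffMul_subset _ _ _ _ _).trans (hfb i))
  have hP0 : ∀ p i, ∀ y ∉ C i, (P p i).1 y = 0 := fun p i y hy =>
    (he (c i)).localSection_apply_of_eq_zero _ _ (image_eq_zero_of_notMem_tsupport fun h =>
      hy (hρt i (tsupport_cutoffMul_subset _ _ _ _ _ h)))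
  have hQ0 : ∀ p i, ∀ y ∉ C i, (Q p i).1 y = 0 := fun p i y hy =>
    (he (c i)).localSection_apply_of_eq_zero _ _ (image_eq_zero_of_notMem_tsupport fun h =>
      hy (hft i (tsupport_cutoffMul_subset _ _ _ _ _ h)))
  have hPQ : ∀ i y, y ∈ C i → ∑ p, ⁅(P p i).1 y, (Q p i).1 y⁆ = ((ρ i y : ℝ) : K) • A.1 y := by
    intro i y hy
    have hyb := hc i hy
    have h1 : ∀ p, (P p i).1 y = ((ρ i y : ℝ) : K) •
        (e (c i)).symm y (l p (e (c i) ⟨y, A.1 y⟩).2) :=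
      fun p => by
        rw [(he (c i)).localSection_apply _ _ hyb]
        exact (he (c i)).symm_smul hyb _ _
    have h2 : ∀ p, (Q p i).1 y = ((f i y : ℝ) : K) • (e (c i)).symm y (v p) :=
      fun p => by
        rw [(he (c i)).localSection_apply _ _ hyb]
        exact (he (c i)).symm_smul hyb _ _
    simp only [h1, h2, smul_lie, lie_smul, ← (he (c i)).symm_lie hyb]
    rw [← Finset.smul_sum, ← Finset.smul_sum, ← (he (c i)).symm_sum hyb, ← hlv,
      (he (c i)).symm_apply hyb]
    by_cases hρy : ρ i y = 0
    · rw [hρy]; simp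
    · have : f i y = 1 := (hf1 i).self_of_nhdsSet y (subset_tsupport _ hρy)
      rw [this]; simp
  -- Only the terms of one colour `k` are kept. Their supports lie in pairwise disjoint sets, so the
  -- bracket of two such locally finite sums has no cross terms; the number of global brackets is
  -- thus at most the number of colours times `n`.
  let B : (ι → lieSections K E 𝔨 L) → Fin 3 × Fin N → ι → lieSections K E 𝔨 L := fun R k i =>
    if col i = k then R i else 0
  have hB : ∀ R : ι → lieSections K E 𝔨 L, (∀ i, ∀ y ∉ C i, (R i).1 y = 0) → ∀ k i, ∀ y ∉ C i,
      (B R k i).1 y = 0 := by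
    intro R hR k i y hy
    by_cases h : col i = k
    · simp only [B, if_pos h]; exact hR i y hy
    · simp only [B, if_neg h]; rfl
  have hBi : ∀ (R : ι → lieSections K E 𝔨 L) (hR : ∀ i, ∀ y ∉ C i, (R i).1 y = 0) (i : ι) (y : M),
      y ∈ C i → (locallyFiniteSum (B R (col i)) hCf (hB R hR (col i))).1 y = (R i).1 y := by
    intro R hR i y hy
    rw [locallyFiniteSum_apply, finsum_eq_single _ i]
    · simp [B]
    · intro j hj
      by_cases h : col j = col i
      · simp only [B, if_pos h]
        exact hR j y fun hyj => disjoint_left.1 (hCd j i hj h) hyj hy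
      · simp only [B, if_neg h]; rfl
  have hmain : A = ∑ k, ∑ p, ⁅locallyFiniteSum (B (P p) k) hCf (hB _ (hP0 p) k),
      locallyFiniteSum (B (Q p) k) hCf (hB _ (hQ0 p) k)⁆ := by
    refine lieSections_ext fun y => ?_
    simp only [lieSections_sum_apply]
    obtain ⟨V, hV, hfin⟩ := hCf y
    have hρ1 : ∑ i ∈ hfin.toFinset, ρ i y = 1 := by
      rw [← ρ.sum_eq_one (mem_univ y), finsum_eq_sum_of_support_subset]
      intro i hi
      rw [Finite.coe_toFinset]
      exact ⟨y, interior_subset (hρ i (subset_tsupport _ hi)), mem_of_mem_nhds hV⟩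
    have hk : ∀ k, ∑ p, ⁅(locallyFiniteSum (B (P p) k) hCf (hB _ (hP0 p) k)).1 y,
        (locallyFiniteSum (B (Q p) k) hCf (hB _ (hQ0 p) k)).1 y⁆ =
        ∑ i ∈ hfin.toFinset with col i = k, ((ρ i y : ℝ) : K) • A.1 y := by
      intro k
      by_cases hex : ∃ i, col i = k ∧ y ∈ C i
      · obtain ⟨i, rfl, hy⟩ := hex
        rw [Finset.sum_congr rfl fun p _ => congrArg₂ (fun v w : L y => ⁅v, w⁆)
          (hBi (P p) (hP0 p) i y hy) (hBi (Q p) (hQ0 p) i y hy), hPQ i y hy]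
        rw [Finset.sum_eq_single i]
        · intro j hj hji
          have : ρ j y = 0 := by
            by_contra h
            exact disjoint_left.1 (hCd j i hji (Finset.mem_filter.1 hj).2)
              (interior_subset (hρ j (subset_tsupport _ h))) hy
          rw [this]; simp
        · intro h
          exact (h (Finset.mem_filter.2
            ⟨(Finite.mem_toFinset _).2 ⟨y, hy, mem_of_mem_nhds hV⟩, rfl⟩)).elim
      · push Not at hex
        rw [Finset.sum_eq_zero, Finset.sum_eq_zero]
        · intro j hj
          have : ρ j y = 0 := by
            by_contra h
            exact hex j (Finset.mem_filter.1 hj).2 (interior_subset (hρ j (subset_tsupport _ h)))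
          rw [this]; simp
        · intro p _
          rw [locallyFiniteSum_apply, finsum_eq_zero_of_forall_eq_zero, zero_lie]
          intro i
          by_cases h : col i = k
          · exact hB _ (hP0 p) k i y (hex i h)
          · simp only [B, if_neg h]; rfl
    -- Each index has exactly one colour, so the sums over the colours regroup to the full partition
    -- of unity.
    refine Eq.trans ?_ (Finset.sum_congr rfl fun k _ => (hk k).symm)
    rw [Finset.sum_fiberwise, ← Finset.sum_smul, ← RCLike.ofReal_sum, hρ1]
    simp
  rw [hmain]
  exact Submodule.sum_mem _ fun k _ => Submodule.sum_mem _ fun p _ =>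
    Submodule.subset_span ⟨_, _, rfl⟩

end LieBundle

end

noncomputable section

/-! ### Point derivations of the algebra of smooth functions -/

section PointDerivation

variable {E : Type*} [NormedAddCommGroup E] [NormedSpace ℝ E]
  {M : Type*} [TopologicalSpace M] [ChartedSpace E M]

/-- The differential of smooth functions at a point, with values in the dual of the tangent
space. -/
def differentialAt (x : M) :
    C^∞⟮𝓘(ℝ, E), M; 𝓘(ℝ, ℝ), ℝ⟯ →ₗ[ℝ] (TangentSpace 𝓘(ℝ, E) x →ₗ[ℝ] ℝ) where
  toFun f := (mfderiv 𝓘(ℝ, E) 𝓘(ℝ, ℝ) f x).toLinearMap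
  map_add' f g := by
    ext v
    exact congrArg (fun l => l v)
      (mfderiv_add (f.contMDiff.mdifferentiableAt (by simp))
        (g.contMDiff.mdifferentiableAt (by simp)))
  map_smul' c f := by
    ext v
    exact congrArg (fun l => l v)
      (const_smul_mfderiv (f.contMDiff.mdifferentiableAt (by simp)) c)

theorem differentialAt_apply (f : C^∞⟮𝓘(ℝ, E), M; 𝓘(ℝ, ℝ), ℝ⟯) (x : M)
    (v : TangentSpace 𝓘(ℝ, E) x) :
    differentialAt x f v = mfderiv 𝓘(ℝ, E) 𝓘(ℝ, ℝ) f x v := rfl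

variable [IsManifold 𝓘(ℝ, E) ∞ M] [FiniteDimensional ℝ E] [T2Space M]

/-- Linear functionals of a chart are locally given by global smooth functions. -/
theorem exists_differentialAt_eq_chart {x₀ x : M} (hx : x ∈ (chartAt E x₀).source)
    (l : E →ₗ[ℝ] ℝ) : ∃ f : C^∞⟮𝓘(ℝ, E), M; 𝓘(ℝ, ℝ), ℝ⟯, ∀ᶠ y in 𝓝 x,
      differentialAt y f =
        l ∘ₗ (mfderiv 𝓘(ℝ, E) 𝓘(ℝ, E) (extChartAt 𝓘(ℝ, E) x₀) y).toLinearMap := by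
  have hU := (chartAt E x₀).open_source.mem_nhds hx
  obtain ⟨ψ, h1, h2⟩ := LieConnection.exists_cutoff (E := E) x hU
  let l' : E →L[ℝ] ℝ := LinearMap.toContinuousLinearMap l
  have hl : ContMDiff 𝓘(ℝ, E) 𝓘(ℝ, ℝ) ∞ l := l'.contMDiff
  let f : C^∞⟮𝓘(ℝ, E), M; 𝓘(ℝ, ℝ), ℝ⟯ := cutoffMul (K := ℝ) (chartAt E x₀).open_source ψ h1
    (fun y => l (extChartAt 𝓘(ℝ, E) x₀ y)) (hl.comp_contMDiffOn contMDiffOn_extChartAt)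
  refine ⟨f, ?_⟩
  -- To compare differentials at `y`, the cut-off has to be 1 on a neighbourhood of `y`.
  filter_upwards [h2.eventually_nhds, hU] with y hy hyU
  have hlM : HasMFDerivAt 𝓘(ℝ, E) 𝓘(ℝ, ℝ) l (extChartAt 𝓘(ℝ, E) x₀ y)
      l' := l'.hasMFDerivAt
  have hφ : MDifferentiableAt 𝓘(ℝ, E) 𝓘(ℝ, E) (extChartAt 𝓘(ℝ, E) x₀) y :=
    (contMDiffAt_extChartAt' (n := ∞) hyU).mdifferentiableAt (by simp)
  have hf : f =ᶠ[𝓝 y] l ∘ extChartAt 𝓘(ℝ, E) x₀ := by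
    filter_upwards [hy] with z hz
    change ψ z • l (extChartAt 𝓘(ℝ, E) x₀ z) = l (extChartAt 𝓘(ℝ, E) x₀ z)
    rw [hz, one_smul]
  have hcomp := ((hlM.comp y hφ.hasMFDerivAt).congr_of_eventuallyEq hf).mfderiv
  ext v
  rw [differentialAt_apply, hcomp]
  rfl

/-- The differential of the chart at `x` is invertible, so every covector is the pullback of a
linear functional on `E`. This turns identities tested on functions into identities tested on all
covectors. -/
theorem differentialAt_surjective (x : M) (α : TangentSpace 𝓘(ℝ, E) x →ₗ[ℝ] ℝ) :
    ∃ f : C^∞⟮𝓘(ℝ, E), M; 𝓘(ℝ, ℝ), ℝ⟯, differentialAt x f = α := by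
  obtain ⟨e, he⟩ := isInvertible_mfderiv_extChartAt (I := 𝓘(ℝ, E))
    (mem_extChartAt_source (I := 𝓘(ℝ, E)) x)
  obtain ⟨f, hf⟩ := exists_differentialAt_eq_chart (mem_chart_source E x)
    (α ∘ₗ e.symm.toLinearMap)
  refine ⟨f, hf.self_of_nhds.trans ?_⟩
  rw [← he]
  ext v
  exact congrArg α (e.symm_apply_apply v)

/-- A point derivation vanishes on functions with vanishing differential. -/
theorem pointDerivation_eq_zero {V : Type*} [AddCommGroup V] [Module ℝ V] {x : M}
    (σ : C^∞⟮𝓘(ℝ, E), M; 𝓘(ℝ, ℝ), ℝ⟯ →ₗ[ℝ] V)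
    (hσ : ∀ f g, σ (f * g) = f x • σ g + g x • σ f)
    {f : C^∞⟮𝓘(ℝ, E), M; 𝓘(ℝ, ℝ), ℝ⟯} (hf : differentialAt x f = 0) : σ f = 0 := by
  have hone : σ 1 = 0 := by
    have := hσ 1 1
    simpa using this
  -- Locality: apply the Leibniz rule to `χ * k = 0`, where `χ` is 1 at `x` and supported where `k`
  -- vanishes.
  have hlocal : ∀ k : C^∞⟮𝓘(ℝ, E), M; 𝓘(ℝ, ℝ), ℝ⟯, (∀ᶠ y in 𝓝 x, k y = 0) → σ k = 0 := by
    intro k hk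
    obtain ⟨χ, h1, h2⟩ := LieConnection.exists_cutoff (E := E) x hk
    have h3 : χ * k = 0 := by
      ext y
      change χ y * k y = 0
      by_cases hy : y ∈ tsupport χ
      · rw [show k y = 0 from h1 hy, mul_zero]
      · rw [image_eq_zero_of_notMem_tsupport hy, zero_mul]
    have := hσ χ k
    rw [h3, h2.self_of_nhds, hk.self_of_nhds] at this
    simpa using this.symm
  set φ := extChartAt 𝓘(ℝ, E) x
  have hT : IsOpen φ.target := isOpen_extChartAt_target x
  obtain ⟨χ, hχ1, hχ2⟩ := LieConnection.exists_cutoff (E := E) (M := E) (φ x)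
    (hT.mem_nhds (mem_extChartAt_target x))
  let g := cutoffMul (K := ℝ) hT χ hχ1 (fun z => f (φ.symm z))
    (f.contMDiff.comp_contMDiffOn (contMDiffOn_extChartAt_symm x))
  have hg : ContDiff ℝ ∞ g := contMDiff_iff_contDiff.1 g.contMDiff
  have hgf : ∀ᶠ z in 𝓝 (φ x), g z = f (φ.symm z) := by
    filter_upwards [hχ2] with z hz
    change χ z • f (φ.symm z) = f (φ.symm z)
    rw [hz, one_smul]
  have hdg : fderiv ℝ g (φ x) = 0 := by
    have h1 : fderiv ℝ g (φ x) = fderiv ℝ (fun z => f (φ.symm z)) (φ x) :=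
      Filter.EventuallyEq.fderiv_eq hgf
    have h2 := (f.contMDiff.mdifferentiableAt (x := x) (by simp)).mfderiv
    ext v
    have h3 : mfderiv 𝓘(ℝ, E) 𝓘(ℝ, ℝ) f x v = 0 := congrArg (fun l => l v) hf
    rw [h2] at h3
    simp only [modelWithCornersSelf_coe, range_id, fderivWithin_univ] at h3
    rw [h1]
    exact h3
  let b := Module.finBasis ℝ E
  -- Near `x` this writes `f` as `f x + ∑ u i * t i`. Both factors vanish at `x`, the `t i` because
  -- the differential of `f` does, so the Leibniz rule kills every product.
  obtain ⟨h, hh, hh0, hgh⟩ := exists_hadamard hg (φ x) b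
  have hU := (chartAt E x).open_source.mem_nhds (mem_chart_source E x)
  obtain ⟨ψ, hψ1, hψ2⟩ := LieConnection.exists_cutoff (E := E) x hU
  have hl : ∀ i, ContMDiff 𝓘(ℝ, E) 𝓘(ℝ, ℝ) ∞ (fun z => b.coord i (z - φ x)) := fun i =>
    ((LinearMap.toContinuousLinearMap (b.coord i)).contDiff.comp
      (contDiff_id.sub contDiff_const)).contMDiff
  let u : Fin (Module.finrank ℝ E) → C^∞⟮𝓘(ℝ, E), M; 𝓘(ℝ, ℝ), ℝ⟯ := fun i =>
    cutoffMul (K := ℝ) (chartAt E x).open_source ψ hψ1 (fun y => b.coord i (φ y - φ x))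
      ((hl i).comp_contMDiffOn contMDiffOn_extChartAt)
  let t : Fin (Module.finrank ℝ E) → C^∞⟮𝓘(ℝ, E), M; 𝓘(ℝ, ℝ), ℝ⟯ := fun i =>
    cutoffMul (K := ℝ) (chartAt E x).open_source ψ hψ1 (fun y => h i (φ y))
      ((hh i).contMDiff.comp_contMDiffOn contMDiffOn_extChartAt)
  have hu : ∀ i, u i x = 0 := fun i => by
    change ψ x • b.coord i (φ x - φ x) = 0
    simp
  have ht : ∀ i, t i x = 0 := fun i => by
    change ψ x • h i (φ x) = 0
    rw [hh0, hdg]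
    simp
  have hsum : σ (f - (f x • 1 + ∑ i, u i * t i)) = 0 := by
    refine hlocal _ ?_
    have hcont : ContinuousAt φ x := continuousAt_extChartAt x
    filter_upwards [hψ2, hcont.eventually hgf, hU] with y hy1 hy2 hyU
    have h1 : φ.symm (φ y) = y := φ.left_inv (by rwa [extChartAt_source])
    have hx1 : g (φ x) = f x := by
      rw [hgf.self_of_nhds]
      exact congrArg f (φ.left_inv (mem_extChartAt_source x))
    rw [h1, hgh, hx1] at hy2
    have h2 : (∑ i, u i * t i : C^∞⟮𝓘(ℝ, E), M; 𝓘(ℝ, ℝ), ℝ⟯) y = ∑ i, u i y * t i y := by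
      rw [← ContMDiffMap.coeFnAddMonoidHom_apply, _root_.map_sum, Finset.sum_apply]
      rfl
    change f y - (f x • 1 + (∑ i, u i * t i : C^∞⟮𝓘(ℝ, E), M; 𝓘(ℝ, ℝ), ℝ⟯) y) = 0
    rw [h2, ← hy2, smul_eq_mul, mul_one, sub_eq_zero]
    congr 1
    refine Finset.sum_congr rfl fun i _ => ?_
    change _ = (ψ y • b.coord i (φ y - φ x)) * (ψ y • h i (φ y))
    rw [hy1, one_smul, one_smul]
    rfl
  rw [_root_.map_sub, sub_eq_zero] at hsum
  rw [hsum, _root_.map_add, _root_.map_smul, hone, smul_zero, zero_add, _root_.map_sum]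
  refine Finset.sum_eq_zero fun i _ => ?_
  rw [hσ, hu, ht, zero_smul, zero_smul, add_zero]

end PointDerivation

section LieBundle

variable {K : Type*} [RCLike K]
  {E : Type*} [NormedAddCommGroup E] [NormedSpace ℝ E]
  {M : Type*} [TopologicalSpace M] [ChartedSpace E M]
  {𝔨 : Type*} [NormedLieRing 𝔨] [NormedSpace ℝ 𝔨] [LieAlgebra K 𝔨]
  {L : M → Type*} [∀ x, LieRing (L x)] [∀ x, LieAlgebra K (L x)]
  [TopologicalSpace (TotalSpace 𝔨 L)] [∀ x, TopologicalSpace (L x)] [FiberBundle 𝔨 L]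
  [IsScalarTower ℝ K 𝔨] [FiniteDimensional K 𝔨] [IsLieAlgebraBundle K E 𝔨 L]

/-! ### The symbol of a derivation -/

/-- Multiplication of sections by a smooth function. -/
def funSmulLinear (a : C^∞⟮𝓘(ℝ, E), M; 𝓘(ℝ, K), K⟯) :
    lieSections K E 𝔨 L →ₗ[K] lieSections K E 𝔨 L where
  toFun A := funSmulSection a A
  map_add' A B := lieSections_ext fun x => smul_add (a x) (A.1 x) (B.1 x)
  map_smul' c A := lieSections_ext fun x => smul_comm (a x) c (A.1 x)

theorem funSmulSection_lie (a : C^∞⟮𝓘(ℝ, E), M; 𝓘(ℝ, K), K⟯) (A B : lieSections K E 𝔨 L) :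
    ⁅funSmulSection a A, B⁆ = funSmulSection a ⁅A, B⁆ :=
  lieSections_ext fun x => smul_lie (a x) (A.1 x) (B.1 x)

theorem lie_funSmulSection (a : C^∞⟮𝓘(ℝ, E), M; 𝓘(ℝ, K), K⟯) (A B : lieSections K E 𝔨 L) :
    ⁅A, funSmulSection a B⁆ = funSmulSection a ⁅A, B⁆ :=
  lieSections_ext fun x => lie_smul (a x) (A.1 x) (B.1 x)

/-- The commutator of an endomorphism of `Γ(L)` with the multiplication by a smooth function. -/
def symbol (D : lieSections K E 𝔨 L →ₗ[K] lieSections K E 𝔨 L)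
    (a : C^∞⟮𝓘(ℝ, E), M; 𝓘(ℝ, K), K⟯) : lieSections K E 𝔨 L →ₗ[K] lieSections K E 𝔨 L :=
  D ∘ₗ funSmulLinear a - funSmulLinear a ∘ₗ D

theorem symbol_apply (D : lieSections K E 𝔨 L →ₗ[K] lieSections K E 𝔨 L)
    (a : C^∞⟮𝓘(ℝ, E), M; 𝓘(ℝ, K), K⟯) (A : lieSections K E 𝔨 L) :
    symbol D a A = D (funSmulSection a A) - funSmulSection a (D A) := rfl

theorem symbol_add (D D' : lieSections K E 𝔨 L →ₗ[K] lieSections K E 𝔨 L)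
    (a : C^∞⟮𝓘(ℝ, E), M; 𝓘(ℝ, K), K⟯) : symbol (D + D') a = symbol D a + symbol D' a := by
  rw [symbol, symbol, symbol, LinearMap.add_comp, LinearMap.comp_add]
  abel

theorem DerSection.incl_lie (D₀ : DerSection K E 𝔨 L) (A B : lieSections K E 𝔨 L) :
    D₀.incl ⁅A, B⁆ = ⁅D₀.incl A, B⁆ + ⁅A, D₀.incl B⁆ :=
  lieSections_ext fun x => ((D₀.toFun x).apply_lie_eq_add (A.1 x) (B.1 x)).trans (add_comm _ _)

theorem symbol_incl_apply (D₀ : DerSection K E 𝔨 L) (a : C^∞⟮𝓘(ℝ, E), M; 𝓘(ℝ, K), K⟯)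
    (A : lieSections K E 𝔨 L) : symbol D₀.incl a A = 0 :=
  sub_eq_zero.2 (lieSections_ext fun x => _root_.map_smul (D₀.toFun x) (a x) (A.1 x))

/-- Computing `D(a[A, B])` as `D[A, aB]` produces `[DA, aB] = a[DA, B]`, which cancels against the
same term of `a D[A, B]`. -/
theorem symbol_mem_lieCentroid {D : lieSections K E 𝔨 L →ₗ[K] lieSections K E 𝔨 L}
    (hD : ∀ A B : lieSections K E 𝔨 L, D ⁅A, B⁆ = ⁅D A, B⁆ + ⁅A, D B⁆)
    (a : C^∞⟮𝓘(ℝ, E), M; 𝓘(ℝ, K), K⟯) : symbol D a ∈ lieCentroid K (lieSections K E 𝔨 L) := by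
  intro A B
  have h : ∀ X Y : lieSections K E 𝔨 L, funSmulSection a (X + Y) =
    funSmulSection a X + funSmulSection a Y := (funSmulLinear a).map_add
  rw [symbol_apply, symbol_apply, ← lie_funSmulSection, hD, hD, h, lie_sub, lie_funSmulSection,
    lie_funSmulSection]
  abel

variable [FiniteDimensional ℝ E] [IsManifold 𝓘(ℝ, E) ∞ M] [T2Space M]

theorem DerSection.incl_injective :
    Function.Injective (DerSection.incl : DerSection K E 𝔨 L → _) := by
  intro D D' h
  refine DerSection.ext (funext fun x => LieDerivation.ext fun v => ?_)
  obtain ⟨A, rfl⟩ := exists_section_apply_eq (K := K) (E := E) (𝔨 := 𝔨) x v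
  exact congrArg (fun T => (T A).1 x) h

/-- On a bracket, `T(a[P, Q]) = T[aP, Q] = [aP, TQ] = aT[P, Q]`, which suffices when brackets span
`Γ(L)`. In the centerfree case, `T(aA) - aT(A)` commutes with all sections by a similar computation,
so its value in each fibre is central. -/
theorem isFunLinear_of_mem_lieCentroid [SigmaCompactSpace M]
    (h𝔨 : IsPerfectLie K 𝔨 ∨ IsCenterfreeLie K 𝔨)
    {T : lieSections K E 𝔨 L →ₗ[K] lieSections K E 𝔨 L}
    (hT : T ∈ lieCentroid K (lieSections K E 𝔨 L)) : IsFunLinear K T := by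
  have hT' : ∀ A B : lieSections K E 𝔨 L, T ⁅A, B⁆ = ⁅A, T B⁆ := hT
  intro a A
  rcases h𝔨 with h | h
  · have hA := mem_span_lie_of_isPerfectLie h A
    change T (funSmulLinear a A) = funSmulLinear a (T A)
    induction hA using Submodule.span_induction with
    | mem A hA =>
      obtain ⟨P, Q, rfl⟩ := hA
      change T (funSmulSection a ⁅P, Q⁆) = funSmulSection a (T ⁅P, Q⁆)
      rw [← funSmulSection_lie, hT', funSmulSection_lie, hT']
    | zero => simp only [_root_.map_zero]
    | add A B _ _ hA hB => simp only [_root_.map_add, hA, hB]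
    | smul c A _ hA => simp only [_root_.map_smul, hA]
  · refine sub_eq_zero.1 (lieSections_ext fun x => ?_)
    set X := T (funSmulSection a A) - funSmulSection a (T A)
    have hX : ∀ B : lieSections K E 𝔨 L, ⁅B, X⁆ = 0 := by
      intro B
      rw [lie_sub, ← hT', lie_funSmulSection, lie_funSmulSection, ← funSmulSection_lie, hT',
        funSmulSection_lie, sub_self]
    have hXx : ∀ v : L x, ⁅v, X.1 x⁆ = 0 := by
      intro v
      obtain ⟨B, rfl⟩ := exists_section_apply_eq (K := K) (E := E) (𝔨 := 𝔨) x v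
      exact congrArg (fun B : lieSections K E 𝔨 L => B.1 x) (hX B)
    obtain ⟨e, hx, he⟩ := IsLieAlgebraBundle.exists_chart (K := K) (E := E) (𝔨 := 𝔨) (L := L) x
    obtain ⟨φ, -⟩ := he.exists_lieEquiv x hx
    have hc : φ (X.1 x) ∈ LieAlgebra.center K 𝔨 := by
      refine (LieModule.mem_maxTrivSubmodule K 𝔨 𝔨 _).2 fun w => ?_
      rw [← φ.apply_symm_apply w, ← LieEquiv.map_lie, hXx]
      exact _root_.map_zero φ
    rw [show LieAlgebra.center K 𝔨 = ⊥ from h, LieSubmodule.mem_bot] at hc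
    exact φ.injective (hc.trans (_root_.map_zero φ).symm)

variable [∀ x, Module ℝ (L x)] [∀ x, IsScalarTower ℝ K (L x)]

/-- The symbol of a derivation of `Γ(L)` at a point. -/
theorem exists_symbolAt [SigmaCompactSpace M]
    (h𝔨 : IsPerfectLie K 𝔨 ∨ IsCenterfreeLie K 𝔨)
    {D : lieSections K E 𝔨 L →ₗ[K] lieSections K E 𝔨 L}
    (hD : ∀ A B : lieSections K E 𝔨 L, D ⁅A, B⁆ = ⁅D A, B⁆ + ⁅A, D B⁆) (x : M) :
    ∃ σ : C^∞⟮𝓘(ℝ, E), M; 𝓘(ℝ, ℝ), ℝ⟯ →ₗ[ℝ] lieCentroid K (L x),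
      (∀ f (A : lieSections K E 𝔨 L), (σ f).1 (A.1 x) = (symbol D (ofRealFun K f) A).1 x) ∧
      ∀ f, differentialAt x f = 0 → σ f = 0 := by
  have hfl := fun f : C^∞⟮𝓘(ℝ, E), M; 𝓘(ℝ, ℝ), ℝ⟯ =>
    isFunLinear_of_mem_lieCentroid h𝔨 (symbol_mem_lieCentroid hD (ofRealFun K f))
  have hcent : ∀ f : C^∞⟮𝓘(ℝ, E), M; 𝓘(ℝ, ℝ), ℝ⟯,
      (hfl f).fiberMap x ∈ lieCentroid K (L x) := by
    intro f v w
    obtain ⟨A, rfl⟩ := exists_section_apply_eq (K := K) (E := E) (𝔨 := 𝔨) x v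
    obtain ⟨B, rfl⟩ := exists_section_apply_eq (K := K) (E := E) (𝔨 := 𝔨) x w
    rw [(hfl f).fiberMap_apply]
    refine ((hfl f).fiberMap_apply x ⁅A, B⁆).trans ?_
    rw [symbol_mem_lieCentroid hD (ofRealFun K f) A B]
    rfl
  have hext : ∀ S T : lieCentroid K (L x),
      (∀ A : lieSections K E 𝔨 L, S.1 (A.1 x) = T.1 (A.1 x)) → S = T := by
    intro S T h
    refine Subtype.ext (LinearMap.ext fun v => ?_)
    obtain ⟨A, rfl⟩ := exists_section_apply_eq (K := K) (E := E) (𝔨 := 𝔨) x v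
    exact h A
  have hval : ∀ f (A : lieSections K E 𝔨 L),
      (hfl f).fiberMap x (A.1 x) = (symbol D (ofRealFun K f) A).1 x :=
    fun f A => (hfl f).fiberMap_apply x A
  let σ : C^∞⟮𝓘(ℝ, E), M; 𝓘(ℝ, ℝ), ℝ⟯ →ₗ[ℝ] lieCentroid K (L x) :=
    { toFun := fun f => ⟨(hfl f).fiberMap x, hcent f⟩
      map_add' := fun f g => hext _ _ fun A => by
        change (hfl (f + g)).fiberMap x (A.1 x) =
          (hfl f).fiberMap x (A.1 x) + (hfl g).fiberMap x (A.1 x)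
        have h1 : ∀ B : lieSections K E 𝔨 L, funSmulSection (ofRealFun K (f + g)) B =
            funSmulSection (ofRealFun K f) B + funSmulSection (ofRealFun K g) B :=
          fun B => lieSections_ext fun y => by
            change ((f y + g y : ℝ) : K) • B.1 y = (f y : K) • B.1 y + (g y : K) • B.1 y
            rw [RCLike.ofReal_add, add_smul]
        rw [hval, hval, hval, symbol_apply, symbol_apply, symbol_apply, h1, h1, _root_.map_add,
          add_sub_add_comm]
        rfl
      map_smul' := fun c f => hext _ _ fun A => by
        change (hfl (c • f)).fiberMap x (A.1 x) = c • (hfl f).fiberMap x (A.1 x)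
        have h1 : ∀ B : lieSections K E 𝔨 L, funSmulSection (ofRealFun K (c • f)) B =
            (c : K) • funSmulSection (ofRealFun K f) B :=
          fun B => lieSections_ext fun y => by
            change ((c * f y : ℝ) : K) • B.1 y = (c : K) • (f y : K) • B.1 y
            rw [RCLike.ofReal_mul, mul_smul]
        rw [hval, hval, symbol_apply, symbol_apply, h1, h1, _root_.map_smul, ← smul_sub,
          RCLike.real_smul_eq_coe_smul (K := K)]
        rfl }
  refine ⟨σ, hval, fun f hf => pointDerivation_eq_zero σ (fun f g => hext _ _ fun A => ?_) hf⟩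
  change (hfl (f * g)).fiberMap x (A.1 x) =
    f x • (hfl g).fiberMap x (A.1 x) + g x • (hfl f).fiberMap x (A.1 x)
  have h1 : ∀ B : lieSections K E 𝔨 L, funSmulSection (ofRealFun K (f * g)) B =
      funSmulSection (ofRealFun K f) (funSmulSection (ofRealFun K g) B) :=
    fun B => lieSections_ext fun y => by
      change ((f y * g y : ℝ) : K) • B.1 y = (f y : K) • (g y : K) • B.1 y
      rw [RCLike.ofReal_mul, mul_smul]
  -- The identity `[D, fg] = [D, f]g + f[D, g]`. Since `[D, f]` is function-linear, it becomes the
  -- Leibniz rule at `x`.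
  have h2 : symbol D (ofRealFun K (f * g)) A =
      symbol D (ofRealFun K f) (funSmulSection (ofRealFun K g) A) +
        funSmulSection (ofRealFun K f) (symbol D (ofRealFun K g) A) := by
    have h3 : ∀ X Y : lieSections K E 𝔨 L, funSmulSection (ofRealFun K f) (X - Y) =
      funSmulSection (ofRealFun K f) X - funSmulSection (ofRealFun K f) Y :=
        (funSmulLinear (ofRealFun K f)).map_sub
    rw [symbol_apply, symbol_apply, symbol_apply, h1, h1, h3]
    abel
  rw [hval, hval, hval, h2, hfl f, RCLike.real_smul_eq_coe_smul (K := K),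
    RCLike.real_smul_eq_coe_smul (K := K), add_comm]
  rfl

/-! ### Sections of `TM ⊗ Cent(L)` -/

omit [∀ x, TopologicalSpace (L x)] [FiniteDimensional ℝ E] [IsManifold 𝓘(ℝ, E) ∞ M] [T2Space M] in
theorem contractCovector_tmul (x : M) (α : TangentSpace 𝓘(ℝ, E) x →ₗ[ℝ] ℝ)
    (v : TangentSpace 𝓘(ℝ, E) x) (S : lieCentroid K (L x)) :
    contractCovector K E L x α (v ⊗ₜ[ℝ] S) = α v • S := by
  simp [contractCovector]

/-- Contractions with the dual basis are the coefficients of a tensor, so covectors separate the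
elements of `T_xM ⊗ Cent(L x)`. -/
theorem eq_sum_tmul_contractCovector {ι : Type*} [Fintype ι] (x : M)
    (b : Module.Basis ι ℝ (TangentSpace 𝓘(ℝ, E) x))
    (t : TangentSpace 𝓘(ℝ, E) x ⊗[ℝ] lieCentroid K (L x)) :
    t = ∑ i, b i ⊗ₜ[ℝ] contractCovector K E L x (b.coord i) t := by
  induction t with
  | zero => simp
  | add s t hs ht =>
    simp only [_root_.map_add, TensorProduct.tmul_add, Finset.sum_add_distrib]
    rw [← hs, ← ht]
  | tmul v S =>
    simp only [contractCovector_tmul, ← TensorProduct.smul_tmul]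
    rw [← TensorProduct.sum_tmul]
    simp only [Module.Basis.coord_apply, b.sum_repr]

theorem contractCovector_ext {x : M} {s t : TangentSpace 𝓘(ℝ, E) x ⊗[ℝ] lieCentroid K (L x)}
    (h : ∀ α, contractCovector K E L x α s = contractCovector K E L x α t) : s = t := by
  let b : Module.Basis _ ℝ (TangentSpace 𝓘(ℝ, E) x) := Module.finBasis ℝ E
  rw [eq_sum_tmul_contractCovector x b s, eq_sum_tmul_contractCovector x b t]
  simp only [h]

/-- A section of `TM ⊗ Cent(L)` representing the symbol of a derivation. -/
theorem exists_tangentCentSection [SigmaCompactSpace M]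
    (h𝔨 : IsPerfectLie K 𝔨 ∨ IsCenterfreeLie K 𝔨)
    {D : lieSections K E 𝔨 L →ₗ[K] lieSections K E 𝔨 L}
    (hD : ∀ A B : lieSections K E 𝔨 L, D ⁅A, B⁆ = ⁅D A, B⁆ + ⁅A, D B⁆) :
    ∃ Y : TangentCentSection K E 𝔨 L, ∀ x f (A : lieSections K E 𝔨 L),
      (contractCovector K E L x (differentialAt x f) (Y.toFun x)).1 (A.1 x) =
        (symbol D (ofRealFun K f) A).1 x := by
  choose σ hσ hσ0 using exists_symbolAt h𝔨 hD
  have hY : ∀ x : M, ∃ t : TangentSpace 𝓘(ℝ, E) x ⊗[ℝ] lieCentroid K (L x),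
      ∀ f, contractCovector K E L x (differentialAt x f) t = σ x f := by
    intro x
    let b : Module.Basis _ ℝ (TangentSpace 𝓘(ℝ, E) x) := Module.finBasis ℝ E
    choose g hg using fun i => differentialAt_surjective x (b.coord i)
    refine ⟨∑ i, b i ⊗ₜ[ℝ] σ x (g i), fun f => ?_⟩
    -- The functions `g i` realise the dual basis, so `f` has the same differential as this
    -- combination and hence the same value under `σ x`.
    have h1 : differentialAt x (f - ∑ i, differentialAt x f (b i) • g i) = 0 := by
      rw [_root_.map_sub, _root_.map_sum, sub_eq_zero]
      refine b.ext fun j => ?_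
      simp [hg, -map_sum]
    have h2 := hσ0 x _ h1
    rw [_root_.map_sub, _root_.map_sum, sub_eq_zero] at h2
    rw [_root_.map_sum, h2]
    simp only [contractCovector_tmul, _root_.map_smul]
  choose Y hY using hY
  refine ⟨⟨Y, fun x₀ l => isSmoothEndOn_of_forall fun A x hx => ?_⟩, fun x f A => ?_⟩
  -- Near `x` the contraction with a chart covector is the symbol of `D` at one global function `f`,
  -- and this maps smooth sections to smooth sections.
  · obtain ⟨f, hf⟩ := exists_differentialAt_eq_chart hx l
    refine ((symbol D (ofRealFun K f) A).2 x).congr_of_eventuallyEq ?_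
    filter_upwards [hf] with y hy
    rw [← hy, hY, hσ]
  · rw [hY, hσ]

/-! ### Symbol and Leibniz rule of the extended connection -/

namespace LieConnection

variable (conn : LieConnection K E 𝔨 L)

theorem atVec_funSmulSection (f : C^∞⟮𝓘(ℝ, E), M; 𝓘(ℝ, ℝ), ℝ⟯) (A : lieSections K E 𝔨 L) (x : M)
    (v : TangentSpace 𝓘(ℝ, E) x) :
    conn.atVec (funSmulSection (ofRealFun K f) A) x v =
      differentialAt x f v • A.1 x + f x • conn.atVec A x v := by
  obtain ⟨X, rfl⟩ := exists_vecField x v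
  rw [conn.atVec_apply, conn.atVec_apply, conn.leibniz, RCLike.real_smul_eq_coe_smul (K := K),
    RCLike.real_smul_eq_coe_smul (K := K) (f x)]
  congr 2
  -- The connection differentiates the `K`-valued function; the chain rule with the inclusion `ℝ →
  -- K` relates this to `df`.
  have h1 : HasMFDerivAt 𝓘(ℝ, ℝ) 𝓘(ℝ, K) (RCLike.ofRealCLM (K := K)) (f x)
      (RCLike.ofRealCLM (K := K)) := ContinuousLinearMap.hasMFDerivAt _
  have h2 := h1.comp x (f.contMDiff.mdifferentiableAt (x := x) (by simp)).hasMFDerivAt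
  exact congrArg (fun l => l (X x)) h2.mfderiv

/-- The first summand is the symbol of `∇_𝒴`: a pure tensor `v ⊗ S` contributes `df(v) S`, because
`S` is linear over `K`. -/
theorem atTensor_funSmulSection (f : C^∞⟮𝓘(ℝ, E), M; 𝓘(ℝ, ℝ), ℝ⟯) (A : lieSections K E 𝔨 L)
    (x : M) (t : TangentSpace 𝓘(ℝ, E) x ⊗[ℝ] lieCentroid K (L x)) :
    conn.atTensor (funSmulSection (ofRealFun K f) A) x t =
      (contractCovector K E L x (differentialAt x f) t).1 (A.1 x) + f x • conn.atTensor A x t := by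
  induction t with
  | zero => simp
  | add s t hs ht =>
    rw [_root_.map_add, hs, ht, _root_.map_add, _root_.map_add, smul_add, Submodule.coe_add,
      LinearMap.add_apply, add_add_add_comm]
  | tmul v S =>
    rw [atTensor_tmul, atTensor_tmul, contractCovector_tmul, conn.atVec_funSmulSection,
      _root_.map_add, RCLike.real_smul_eq_coe_smul (K := K),
      RCLike.real_smul_eq_coe_smul (K := K) (f x), _root_.map_smul, _root_.map_smul,
      ← RCLike.real_smul_eq_coe_smul, ← RCLike.real_smul_eq_coe_smul]
    rfl

theorem symbol_extension_apply (Y : TangentCentSection K E 𝔨 L)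
    (f : C^∞⟮𝓘(ℝ, E), M; 𝓘(ℝ, ℝ), ℝ⟯) (A : lieSections K E 𝔨 L) (x : M) :
    (symbol (conn.extension Y) (ofRealFun K f) A).1 x =
      (contractCovector K E L x (differentialAt x f) (Y.toFun x)).1 (A.1 x) := by
  change conn.atTensor (funSmulSection (ofRealFun K f) A) x (Y.toFun x) -
    (f x : K) • conn.atTensor A x (Y.toFun x) = _
  rw [conn.atTensor_funSmulSection, ← RCLike.real_smul_eq_coe_smul, add_sub_cancel_right]

omit [∀ x, IsScalarTower ℝ K (L x)] in
theorem atVec_lie (A B : lieSections K E 𝔨 L) (x : M) (v : TangentSpace 𝓘(ℝ, E) x) :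
    conn.atVec ⁅A, B⁆ x v = ⁅conn.atVec A x v, B.1 x⁆ + ⁅A.1 x, conn.atVec B x v⁆ := by
  obtain ⟨X, rfl⟩ := exists_vecField x v
  rw [conn.atVec_apply, conn.atVec_apply, conn.atVec_apply, conn.map_lie]
  rfl

/-- An element of the centroid moves into either slot of a bracket, into the first one by
antisymmetry, so composing with it preserves the Leibniz rule of `∇_v`. -/
theorem atTensor_lie (A B : lieSections K E 𝔨 L) (x : M)
    (t : TangentSpace 𝓘(ℝ, E) x ⊗[ℝ] lieCentroid K (L x)) :
    conn.atTensor ⁅A, B⁆ x t = ⁅conn.atTensor A x t, B.1 x⁆ + ⁅A.1 x, conn.atTensor B x t⁆ := by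
  induction t with
  | zero => simp
  | add s t hs ht =>
    simp only [_root_.map_add, hs, ht, add_lie, lie_add]
    abel
  | tmul v S =>
    have h1 : ∀ a b : L x, S.1 ⁅a, b⁆ = ⁅a, S.1 b⁆ := S.2
    have h2 : ∀ a b : L x, S.1 ⁅a, b⁆ = ⁅S.1 a, b⁆ := fun a b => by
      rw [← lie_skew, _root_.map_neg, h1, lie_skew]
    rw [atTensor_tmul, atTensor_tmul, atTensor_tmul, conn.atVec_lie, _root_.map_add, h1 (A.1 x), h2]

theorem extension_lie (Y : TangentCentSection K E 𝔨 L) (A B : lieSections K E 𝔨 L) :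
    conn.extension Y ⁅A, B⁆ = ⁅conn.extension Y A, B⁆ + ⁅A, conn.extension Y B⁆ :=
  lieSections_ext fun x => conn.atTensor_lie A B x (Y.toFun x)

end LieConnection

end LieBundle

end

/-! ### The decomposition and its uniqueness -/

theorem mainTheorem4
    {K : Type*} [RCLike K]
    {E : Type*} [NormedAddCommGroup E] [NormedSpace ℝ E] [FiniteDimensional ℝ E]
    {M : Type*} [TopologicalSpace M] [ChartedSpace E M] [IsManifold 𝓘(ℝ, E) ∞ M]
    [T2Space M] [ParacompactSpace M] [ConnectedSpace M]
    {𝔨 : Type*} [NormedLieRing 𝔨] [NormedSpace ℝ 𝔨] [LieAlgebra K 𝔨] [IsScalarTower ℝ K 𝔨]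
    [FiniteDimensional K 𝔨]
    {L : M → Type*} [∀ x, LieRing (L x)] [∀ x, LieAlgebra K (L x)]
    [∀ x, Module ℝ (L x)] [∀ x, IsScalarTower ℝ K (L x)]
    [TopologicalSpace (TotalSpace 𝔨 L)] [∀ x, TopologicalSpace (L x)] [FiberBundle 𝔨 L]
    [VectorBundle ℝ 𝔨 L] [ContMDiffVectorBundle ∞ 𝔨 L 𝓘(ℝ, E)]
    [IsLieAlgebraBundle K E 𝔨 L]
    (conn : LieConnection K E 𝔨 L)
    (h𝔨 : IsPerfectLie K 𝔨 ∨ IsCenterfreeLie K 𝔨) :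
    (∀ D : lieSections K E 𝔨 L →ₗ[K] lieSections K E 𝔨 L,
      (∀ A B : lieSections K E 𝔨 L, D ⁅A, B⁆ = ⁅D A, B⁆ + ⁅A, D B⁆) ↔
        ∃ (Y : TangentCentSection K E 𝔨 L) (D₀ : DerSection K E 𝔨 L),
          D = conn.extension Y + D₀.incl) ∧
    (∀ (Y Y' : TangentCentSection K E 𝔨 L) (D₀ D₀' : DerSection K E 𝔨 L),
      conn.extension Y + D₀.incl = conn.extension Y' + D₀'.incl → Y = Y' ∧ D₀ = D₀') := by
  have : LocallyCompactSpace M := ChartedSpace.locallyCompactSpace E M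
  have : SigmaCompactSpace M := sigmaCompactSpace_of_connected M
  refine ⟨fun D => ⟨fun hD => ?_, ?_⟩, fun Y Y' D₀ D₀' h => ?_⟩
  · obtain ⟨Y, hY⟩ := exists_tangentCentSection h𝔨 hD
    -- Equal symbols on real functions mean that the difference commutes with multiplication by
    -- them, and this extends to `K`-valued functions.
    have hlin : IsFunLinear K (D - conn.extension Y) := by
      refine isFunLinear_of_real fun f A => lieSections_ext fun x => ?_
      have h1 := hY x f A
      rw [← conn.symbol_extension_apply, symbol_apply, symbol_apply] at h1
      change (D (funSmulSection (ofRealFun K f) A)).1 x -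
        (conn.extension Y (funSmulSection (ofRealFun K f) A)).1 x =
          (f x : K) • ((D A).1 x - (conn.extension Y A).1 x)
      change (conn.extension Y (funSmulSection (ofRealFun K f) A)).1 x -
          (f x : K) • (conn.extension Y A).1 x =
        (D (funSmulSection (ofRealFun K f) A)).1 x - (f x : K) • (D A).1 x at h1
      rw [smul_sub, sub_eq_sub_iff_add_eq_add]
      rw [sub_eq_sub_iff_add_eq_add] at h1
      rw [← h1, add_comm]
    obtain ⟨D₀, hD₀⟩ := hlin.exists_derSection fun A B => by
      simp only [LinearMap.sub_apply, hD, conn.extension_lie, sub_lie, lie_sub]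
      abel
    exact ⟨Y, D₀, by rw [← hD₀]; abel⟩
  · rintro ⟨Y, D₀, rfl⟩ A B
    simp only [LinearMap.add_apply, conn.extension_lie, D₀.incl_lie, add_lie, lie_add]
    abel
  -- Taking symbols removes the fibrewise derivations; testing on every covector and every fibre
  -- vector recovers the tensor.
  · have hYY : Y = Y' := by
      refine TangentCentSection.ext (funext fun x => contractCovector_ext fun α => ?_)
      obtain ⟨f, rfl⟩ := differentialAt_surjective x α
      refine Subtype.ext (LinearMap.ext fun v => ?_)
      obtain ⟨A, rfl⟩ := exists_section_apply_eq (K := K) (E := E) (𝔨 := 𝔨) x v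
      rw [← conn.symbol_extension_apply, ← conn.symbol_extension_apply]
      have h1 := congrArg (fun T => (symbol T (ofRealFun K f) A).1 x) h
      simpa only [symbol_add, LinearMap.add_apply, symbol_incl_apply, add_zero] using h1
    subst hYY
    exact ⟨rfl, DerSection.incl_injective (add_left_cancel h)⟩
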